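/- Let $X$ be a Gromov hyperbolic metric space, i.e. for some $\delta\ge 0$ one has $(x|z)_o\ge\min\{(x|y)_o,(y|z)_o\}-\delta$ for all $o,x,y,z\in X$, where $(x|y)_o=\frac12(|ox|+|oy|-|xy|)$. A sequence $(x_i)$ in $X$ converges to infinity if $(x_i|x_j)_o\to\infty$ as $i,j\to\infty$; two such sequences are equivalent if $(x_i|x_i')_o\to\infty$, and $\partial_\infty X$ is the set of equivalence classes. For $\xi,\xi'\in\partial_\infty X$ and $y\in X$ put $(\xi|\xi')_o=\inf\liminf_i(x_i|x_i')_o\in[0,\infty]$ and $(y|\xi)_o=\inf\liminf_i(y|x_i)_o$, the infima over all $(x_i)\in\xi$, $(x_i')\in\xi'$. Assume that $X$ is visual: there are $o\in X$ and $D>0$ such that for every $y\in X$ there is $\xi\in\partial_\infty X$ with $|oy|\le(y|\xi)_o+D$. Let $d$ be any visual metric on $\partial_\infty X$, i.e. a metric for which there are $o\in X$, $a>1$ and $c_1,c_2>0$ with $c_1a^{-(\xi|\xi')_o}\le d(\xi,\xi')\le c_2a^{-(\xi|\xi')_o}$ for all $\xi,\xi'\in\partial_\infty X$ (where $a^{-\infty}=0$),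 and assume that $(\partial_\infty X,d)$ is doubling: for some $C$, every ball of radius $r>0$ can be covered by at most $C$ balls of radius $r/2$. Then the capacity dimension $n$ of $(\partial_\infty X,d)$ is finite, and $X$ admits a quasi-isometric embedding into the product of $n+1$ copies of the binary metric tree, that is, a map $f$ such that for some $a_1,a_2>0$, $b\ge0$ one has $a_1|xx'|-b\le|f(x)f(x')|\le a_2|xx'|+b$ for all $x,x'\in X$. Here the binary metric tree is the simplicial metric tree with all edges of length $1$ and all vertices of valence $3$, the product carries the maximum metric (the $\ell_1$ or $\ell_2$ product metric gives an equivalent statement), and the capacity dimension of a metric space $Z$ is the minimal integer $m\ge0$ for which there is $\delta>0$ such that for every sufficiently small $\tau>0$ there is an open covering $\mathcal U$ of $Z$ which is the union of $m+1$ families, each consisting of pairwise disjoint sets, with $\operatorname{diam}U\le\tau$ for all $U\in\mathcal U$ and Lebesgue number $\inf_{z\in Z}\sup_{U\in\mathcal U}\operatorname{dist}(z,Z\setminus U)\ge\delta\tau$ (where $\operatorname{dist}(z,\emptyset)=\infty$). -/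

import Mathlib

open Filter Topology

noncomputable section

/-! ### Hyperbolic spaces -/

/-- The Gromov product `(x|y)_o`. -/
def gromovProd {X : Type*} [MetricSpace X] (o x y : X) : ℝ :=
  (dist o x + dist o y - dist x y) / 2

/-- `(a, b, c)` is a `δ`-triple: each entry is at least the minimum of the other two minus `δ`. -/
def IsDeltaTriple (δ a b c : ℝ) : Prop :=
  min b c - δ ≤ a ∧ min c a - δ ≤ b ∧ min a b - δ ≤ c

/-- Gromov hyperbolic metric spaces. -/
class GromovHyperbolic (X : Type*) [MetricSpace X] : Prop where
  exists_delta : ∃ δ : ℝ, 0 ≤ δ ∧ ∀ o x y z : X,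
    IsDeltaTriple δ (gromovProd o x y) (gromovProd o y z) (gromovProd o x z)

/-! ### The boundary at infinity -/

/-- The sequence `x` converges to infinity: `(x_i|x_j)_o → ∞` as `i, j → ∞`. The condition does
not depend on the base point, see `tendsto_gromovProd_of_base`. -/
def ConvergesToInfinity {X : Type*} [MetricSpace X] (x : ℕ → X) : Prop :=
  ∀ o : X, Tendsto (fun p : ℕ × ℕ => gromovProd o (x p.1) (x p.2)) atTop atTop

theorem gromovProd_base {X : Type*} [MetricSpace X] (o o' x y : X) :
    gromovProd o x y - dist o o' ≤ gromovProd o' x y := by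
  unfold gromovProd
  have h1 := dist_triangle o o' x
  have h2 := dist_triangle o o' y
  linarith

theorem tendsto_gromovProd_of_base {X ι : Type*} [MetricSpace X] {l : Filter ι} {x y : ι → X}
    (o o' : X) (h : Tendsto (fun i => gromovProd o (x i) (y i)) l atTop) :
    Tendsto (fun i => gromovProd o' (x i) (y i)) l atTop :=
  tendsto_atTop_mono (fun i => gromovProd_base o o' (x i) (y i))
    (tendsto_atTop_add_const_right l (-dist o o') h)

/-- Sequences converging to infinity, where `x` and `y` are equivalent if `(x_i|y_i)_o → ∞`. -/
def boundarySetoid (X : Type*) [MetricSpace X] [GromovHyperbolic X] :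
    Setoid {x : ℕ → X // ConvergesToInfinity x} where
  r x y := ∀ o : X, Tendsto (fun i => gromovProd o (x.1 i) (y.1 i)) atTop atTop
  iseqv :=
    { refl := fun x o => (x.2 o).comp tendsto_atTop_diagonal
      symm := by
        intro x y h o
        refine (h o).congr fun i => ?_
        simp only [gromovProd, dist_comm (x.1 i) (y.1 i)]
        ring
      trans := by
        intro x y z hxy hyz o
        obtain ⟨δ, -, hδ⟩ := GromovHyperbolic.exists_delta (X := X)
        refine tendsto_atTop_mono (fun i => (hδ o (x.1 i) (y.1 i) (z.1 i)).2.2) ?_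
        refine tendsto_atTop_add_const_right _ (-δ) ?_
        rw [tendsto_atTop]
        intro b
        filter_upwards [tendsto_atTop.1 (hxy o) b, tendsto_atTop.1 (hyz o) b] with i h1 h2
        exact le_min h1 h2 }

/-- The boundary at infinity of a hyperbolic space. -/
def GromovBoundary (X : Type*) [MetricSpace X] [GromovHyperbolic X] : Type _ :=
  Quotient (boundarySetoid X)

/-- The sequence `x` belongs to the class `ξ`. -/
def GromovBoundary.Mem {X : Type*} [MetricSpace X] [GromovHyperbolic X]
    (ξ : GromovBoundary X) (x : ℕ → X) : Prop :=
  ∃ h : ConvergesToInfinity x, Quotient.mk (boundarySetoid X) ⟨x, h⟩ = ξ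

/-- `(ξ|ξ')_o = inf liminf (x_i|x'_i)_o`, the infimum over all `x ∈ ξ` and `x' ∈ ξ'`. -/
def boundaryProd {X : Type*} [MetricSpace X] [GromovHyperbolic X] (o : X)
    (ξ ξ' : GromovBoundary X) : EReal :=
  ⨅ (x : ℕ → X) (_ : ξ.Mem x) (x' : ℕ → X) (_ : ξ'.Mem x'),
    liminf (fun i => (gromovProd o (x i) (x' i) : EReal)) atTop

/-- `(y|ξ)_o = inf liminf (y|x_i)_o`, the infimum over all `x ∈ ξ`, for a point `y` of the space. -/
def pointBoundaryProd {X : Type*} [MetricSpace X] [GromovHyperbolic X] (o y : X)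
    (ξ : GromovBoundary X) : EReal :=
  ⨅ (x : ℕ → X) (_ : ξ.Mem x), liminf (fun i => (gromovProd o y (x i) : EReal)) atTop

/-- Visual hyperbolic spaces. -/
def IsVisualSpace (X : Type*) [MetricSpace X] [GromovHyperbolic X] : Prop :=
  ∃ (o : X) (D : ℝ), 0 < D ∧ ∀ y : X, ∃ ξ : GromovBoundary X,
    ((dist o y : ℝ) : EReal) ≤ pointBoundaryProd o y ξ + (D : EReal)

/-- `a ^ (-t)` for `t ∈ [0, ∞]`, with `a ^ (-∞) = 0`. -/
def powNeg (a : ℝ) (t : EReal) : ℝ :=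
  if t = ⊤ then 0 else a ^ (-t.toReal)

/-- The given metric on the boundary at infinity of `X` is visual, with respect to some base
point `o` and some parameter `a > 1`. -/
def IsVisualMetric (X : Type*) [MetricSpace X] [GromovHyperbolic X]
    [MetricSpace (GromovBoundary X)] : Prop :=
  ∃ (o : X) (a c₁ c₂ : ℝ), 1 < a ∧ 0 < c₁ ∧ 0 < c₂ ∧ ∀ ξ ξ' : GromovBoundary X,
    c₁ * powNeg a (boundaryProd o ξ ξ') ≤ dist ξ ξ' ∧
      dist ξ ξ' ≤ c₂ * powNeg a (boundaryProd o ξ ξ')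

/-! ### Doubling spaces and capacity dimension -/

/-- Doubling: every ball of radius `r` is covered by at most `C` balls of radius `r / 2`. -/
def IsDoublingSpace (Z : Type*) [MetricSpace Z] : Prop :=
  ∃ C : ℕ, 1 ≤ C ∧ ∀ (z : Z) (r : ℝ), 0 < r →
    ∃ S : Finset Z, S.card ≤ C ∧ Metric.ball z r ⊆ ⋃ s ∈ S, Metric.ball s (r / 2)

/-- The supremum of the diameters of the members of a family of sets. -/
def mesh {Z : Type*} [MetricSpace Z] (𝒰 : Set (Set Z)) : ENNReal :=
  ⨆ U ∈ 𝒰, Metric.ediam U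

/-- The Lebesgue number of a covering, `inf_z sup_U dist (z, Z \ U)`, where the distance to the
empty set is `∞`. It is not cut off at the mesh, which is `0` for fine coverings of a space such as
a pair of points; the capacity dimension of a point or of a finite set is `0`. -/
def lebesgueNumber {Z : Type*} [MetricSpace Z] (𝒰 : Set (Set Z)) : ENNReal :=
  ⨅ z : Z, ⨆ U ∈ 𝒰, Metric.infEDist z Uᶜ

/-- The union of the families `𝒰 c`, `c` in the set of `k` colors, is a `k`-colored open covering:
each family is disjoint, its members are open, and all members together cover the space. -/
structure IsColoredOpenCovering {Z : Type*} [MetricSpace Z] {k : ℕ}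
    (𝒰 : Fin k → Set (Set Z)) : Prop where
  isOpen : ∀ c, ∀ U ∈ 𝒰 c, IsOpen U
  disjoint : ∀ c, (𝒰 c).PairwiseDisjoint id
  covers : ⋃₀ (⋃ c, 𝒰 c) = Set.univ

/-- The defining property of `cdim Z ≤ m`. -/
def CapacityDimProperty (Z : Type*) [MetricSpace Z] (m : ℕ) : Prop :=
  ∃ δ : ℝ, 0 < δ ∧ ∃ τ₀ : ℝ, 0 < τ₀ ∧ ∀ τ : ℝ, 0 < τ → τ < τ₀ →
    ∃ 𝒰 : Fin (m + 1) → Set (Set Z), IsColoredOpenCovering 𝒰 ∧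
      mesh (⋃ c, 𝒰 c) ≤ ENNReal.ofReal τ ∧
      ENNReal.ofReal (δ * τ) ≤ lebesgueNumber (⋃ c, 𝒰 c)

/-- The capacity dimension: the minimal `m` with the property above, `∞` if there is none. -/
def capacityDim (Z : Type*) [MetricSpace Z] : ℕ∞ :=
  ⨅ (m : ℕ) (_ : CapacityDimProperty Z m), (m : ℕ∞)

/-! ### The binary metric tree -/

/-- The vertices of the binary tree are the words over `Fin 3` without two equal adjacent letters;
`a :: w` is joined to `w`, so that the empty word has the three neighbours `[a]`, and `b :: w` has
the neighbours `w` and `a :: b :: w` for the two letters `a ≠ b`. The edge from `w` to `a :: w` is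
labelled by `a :: w`. The vertex `w` is placed in the space `ℓ¹` over the labels at the sum of the
unit vectors of the edges on the path from the root to `w`. -/
def treeVertex : List (Fin 3) → lp (fun _ : List (Fin 3) => ℝ) 1
  | [] => 0
  | a :: w => treeVertex w + lp.single 1 (a :: w) (1 : ℝ)

/-- The binary metric tree: the union of the unit segments which realize the edges. The distance
in `ℓ¹` of two of its points is the length of the arc of the tree between them, since this arc is
the symmetric difference of the arcs from the root. -/
def BinaryMetricTree : Type :=
  {x : lp (fun _ : List (Fin 3) => ℝ) 1 // ∃ (a : Fin 3) (w : List (Fin 3)),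
    (a :: w).IsChain (· ≠ ·) ∧ x ∈ segment ℝ (treeVertex w) (treeVertex (a :: w))}

instance instMetricSpaceBinaryMetricTree : MetricSpace BinaryMetricTree :=
  inferInstanceAs (MetricSpace {x : lp (fun _ : List (Fin 3) => ℝ) 1 //
    ∃ (a : Fin 3) (w : List (Fin 3)),
      (a :: w).IsChain (· ≠ ·) ∧ x ∈ segment ℝ (treeVertex w) (treeVertex (a :: w))})

/-! ### Quasi-isometric embeddings -/

def IsQuasiIsometricEmbedding {X Y : Type*} [MetricSpace X] [MetricSpace Y] (f : X → Y) : Prop :=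
  ∃ a₁ a₂ b : ℝ, 0 < a₁ ∧ 0 < a₂ ∧ 0 ≤ b ∧ ∀ x x' : X,
    a₁ * dist x x' - b ≤ dist (f x) (f x') ∧ dist (f x) (f x') ≤ a₂ * dist x x' + b

end

/-! ### Local colorings of doubling spaces -/

/-! The boundary `Z` determines `X` up to bounded errors. By visuality each `x` lies near a ray from
`o` to some boundary point `ξ x`. If `k`, `k'` are the levels of `x`, `x'` (their distances from `o`
in suitable units) and `N ≤ min k k'` is the last level on which `ξ x` and `ξ x'` are still close,
then `(x|x')_o` is a multiple of `N`, and `|xx'|` the same multiple of `k + k' - 2N`, up to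
constants. It remains to embed this cone over `Z`, which is `exists_cone_embedding`. Finiteness of
the capacity dimension comes from doubling, through the local colorings of
`IsDoublingSpace.exists_local_coloring`.

Coverings at geometrically decreasing scales are modified, color by color, into laminar families of
rooms (`CapacityDimProperty.exists_laminar`). In one color the rooms around a point form a branch of
a tree of rooms, and two points that are close at level `N` share their branches up to that level,
except for two rooms. Each level has a room of some color, so one of the `n + 1` colors holds its
share of the levels between `N` and `k`.

The tree of rooms may have unbounded valence: a color can skip many levels, and then a room has many
successors, which no finite alphabet can name. Therefore the branch is written as a diary. A room
contributes one entry for each level since the previous room, namely the local color of its base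
point on that level; at most `Λ` entries are written per room, and the others wait on a stack. In a
color with its share of the rooms the capacity suffices to work off the stack. If two diaries agreed
on half of the rooms beyond level `N`, the entries of level `N + 3` would agree
(`exists_entry_eq_of_diary_eq`), and the local coloring would bring the two points closer than they
are (`IsLaminar.not_roomDiary_suffix`). Ruler bits in the entries make sure that equal positions
refer to equal levels. Finally, words over a finite alphabet fit into the binary tree
(`exists_tree_coding`). -/

theorem exists_coloring_of_bounded_degree {α : Type*} (adj : α → α → Prop)
    (hsymm : ∀ a b, adj a b → adj b a) (Q : ℕ)
    (h : ∀ a, ∃ S : Finset α, S.card ≤ Q ∧ ∀ b, adj a b → b ∈ S) :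
    ∃ χ : α → Fin (Q + 1), ∀ a b, a ≠ b → adj a b → χ a ≠ χ b := by
  classical
  choose S hS hadj using h
  have hpick : ∀ T : Finset (Fin (Q + 1)), ∃ c, T.card ≤ Q → c ∉ T := by
    intro T
    by_cases hT : T.card ≤ Q
    · have : T ≠ Finset.univ := by
        rintro rfl
        simp at hT
      obtain ⟨c, hc⟩ := not_forall.1 (fun h => this (Finset.eq_univ_iff_forall.2 h))
      exact ⟨c, fun _ => hc⟩
    · exact ⟨0, fun h => absurd h hT⟩
  choose pick hpick using hpick
  -- Greedy coloring along a well-order: each vertex avoids the colors of its earlier neighbors.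
  -- Members of `S a` that are not earlier contribute the dummy color `0`; the avoided set still has
  -- at most `Q` elements.
  let F : (a : α) → ((b : α) → WellOrderingRel b a → Fin (Q + 1)) → Fin (Q + 1) := fun a ih =>
    pick ((S a).image fun b => if hb : WellOrderingRel b a then ih b hb else 0)
  let χ : α → Fin (Q + 1) := (IsWellFounded.wf (r := (WellOrderingRel : α → α → Prop))).fix F
  have hχ : ∀ a, χ a = pick ((S a).image fun b => if WellOrderingRel b a then χ b else 0) := by
    intro a
    have := (IsWellFounded.wf (r := (WellOrderingRel : α → α → Prop))).fix_eq F a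
    simpa [F, χ] using this
  have key : ∀ a b, WellOrderingRel b a → adj a b → χ a ≠ χ b := by
    intro a b hba hab heq
    have h1 := hpick ((S a).image fun b => if WellOrderingRel b a then χ b else 0)
      (Finset.card_image_le.trans (hS a))
    rw [← hχ a] at h1
    refine h1 (Finset.mem_image.2 ⟨b, hadj a b hab, ?_⟩)
    rw [if_pos hba, heq]
  refine ⟨χ, fun a b hne hab => ?_⟩
  rcases trichotomous_of WellOrderingRel a b with hlt | heq | hgt
  · exact (key b a hlt (hsymm a b hab)).symm
  · exact absurd heq hne
  · exact key a b hgt hab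

theorem exists_cover_ball_div_two_pow {Z : Type*} [MetricSpace Z] {C : ℕ}
    (hC : ∀ (z : Z) (r : ℝ), 0 < r →
      ∃ S : Finset Z, S.card ≤ C ∧ Metric.ball z r ⊆ ⋃ s ∈ S, Metric.ball s (r / 2))
    (z : Z) {r : ℝ} (hr : 0 < r) (m : ℕ) :
    ∃ S : Finset Z, S.card ≤ C ^ m ∧ Metric.ball z r ⊆ ⋃ s ∈ S, Metric.ball s (r / 2 ^ m) := by
  classical
  induction m with
  | zero => exact ⟨{z}, by simp, by simp⟩
  | succ m ih =>
    obtain ⟨S, hS, hcov⟩ := ih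
    choose T hT hTcov using fun s : Z => hC s (r / 2 ^ m) (by positivity)
    refine ⟨S.biUnion T, ?_, ?_⟩
    · calc (S.biUnion T).card ≤ S.card * C := Finset.card_biUnion_le_card_mul _ _ _ fun s _ => hT s
        _ ≤ C ^ m * C := Nat.mul_le_mul_right _ hS
        _ = C ^ (m + 1) := (pow_succ _ _).symm
    · intro x hx
      obtain ⟨s, hs, hxs⟩ := Set.mem_iUnion₂.1 (hcov hx)
      obtain ⟨t, ht, hxt⟩ := Set.mem_iUnion₂.1 (hTcov s hxs)
      refine Set.mem_iUnion₂.2 ⟨t, Finset.mem_biUnion.2 ⟨s, hs, ht⟩, ?_⟩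
      rwa [pow_succ, ← div_div]

theorem exists_maximal_separated (Z : Type*) [MetricSpace Z] (τ : ℝ) :
    ∃ P : Set Z, (P.Pairwise fun x y => τ ≤ dist x y) ∧ ∀ z, 0 < τ → ∃ p ∈ P, dist z p < τ := by
  obtain ⟨P, hP⟩ := zorn_subset {P : Set Z | P.Pairwise fun x y => τ ≤ dist x y} (by
    intro c hc hchain
    refine ⟨⋃₀ c, ?_, fun s hs => Set.subset_sUnion_of_mem hs⟩
    exact (Set.pairwise_sUnion hchain.directedOn).2 hc)
  refine ⟨P, hP.prop, fun z hτ => ?_⟩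
  by_contra! hcon
  have hz : z ∉ P := fun h => by
    have := hcon z h
    rw [dist_self] at this
    linarith
  have : insert z P ⊆ P := hP.2 (by
    refine hP.prop.insert fun p hp _ => ⟨hcon p hp, ?_⟩
    rw [dist_comm]
    exact hcon p hp) (Set.subset_insert _ _)
  exact hz (this (Set.mem_insert _ _))

/-- Distinct points of a maximal `τ`-separated net at distance less than `(|A| + 3) τ` get different
colors, and every point inherits the color of a net point within `τ`. Doubling bounds the degree
independently of `τ`: a ball of radius at most `τ / 2` contains at most one net point. -/
theorem IsDoublingSpace.exists_local_coloring {Z : Type*} [MetricSpace Z] (h : IsDoublingSpace Z)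
    (A : ℝ) : ∃ Q : ℕ, ∀ τ : ℝ, 0 < τ → ∃ χ : Z → Fin (Q + 1),
      ∀ x y, χ x = χ y → dist x y ≤ A * τ → dist x y ≤ 2 * τ := by
  classical
  obtain ⟨C, -, hC⟩ := h
  -- After `m` halvings the radius `(|A| + 3) τ` is below `τ / 2`.
  obtain ⟨m, hm⟩ := pow_unbounded_of_one_lt (2 * (|A| + 3)) (one_lt_two (α := ℝ))
  refine ⟨C ^ m, fun τ hτ => ?_⟩
  obtain ⟨P, hsep, hcov⟩ := exists_maximal_separated Z τ
  choose p hpP hp using fun z => hcov z hτ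
  obtain ⟨χ, hχ⟩ := exists_coloring_of_bounded_degree
    (fun x y : Z => x ∈ P ∧ y ∈ P ∧ dist x y < (|A| + 3) * τ)
    (fun x y h => ⟨h.2.1, h.1, by rw [dist_comm]; exact h.2.2⟩) (C ^ m) (by
      intro x
      obtain ⟨S, hS, hSc⟩ := exists_cover_ball_div_two_pow hC x
        (r := (|A| + 3) * τ) (by positivity) m
      let g : Z → Z := fun s => if h : ∃ q ∈ P, dist q s < τ / 2 then h.choose else s
      refine ⟨S.image g, Finset.card_image_le.trans hS, ?_⟩
      rintro y ⟨-, hyP, hy⟩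
      obtain ⟨s, hs, hys⟩ := Set.mem_iUnion₂.1 (hSc (show y ∈ Metric.ball x _ by
        rw [Metric.mem_ball, dist_comm]; exact hy))
      have hys' : dist y s < τ / 2 := by
        refine (Metric.mem_ball.1 hys).trans_le ?_
        rw [div_le_div_iff₀ (by positivity) (by norm_num)]
        nlinarith
      have hex : ∃ q ∈ P, dist q s < τ / 2 := ⟨y, hyP, hys'⟩
      refine Finset.mem_image.2 ⟨s, hs, ?_⟩
      simp only [g, dif_pos hex]
      by_contra hne
      have h1 := hsep hex.choose_spec.1 hyP hne
      have h2 := dist_triangle_right hex.choose y s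
      linarith [hex.choose_spec.2])
  refine ⟨fun z => χ (p z), fun x y hxy hd => ?_⟩
  have hpxy : p x = p y := by
    by_contra hne
    refine hχ _ _ hne ⟨hpP x, hpP y, ?_⟩ hxy
    have h1 := dist_triangle4 (p x) x y (p y)
    have h2 := hp x
    rw [dist_comm] at h2
    have h3 := hp y
    have : A * τ ≤ |A| * τ := mul_le_mul_of_nonneg_right (le_abs_self A) hτ.le
    nlinarith
  have h1 := dist_triangle_right x y (p x)
  have h2 := hp x
  have h3 := hp y
  rw [← hpxy] at h3
  linarith

/-! ### Finiteness of the capacity dimension -/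

/-- At scale `τ / 4`, points of equal color within `5 τ / 4` are within `τ / 2`, so being within `τ
/ 2` is transitive on each color. The classes have diameter at most `τ / 2` and distinct ones of one
color are `τ / 4` apart; their `τ / 8`-thickenings are the covering. -/
theorem IsDoublingSpace.exists_capacityDimProperty {Z : Type*} [MetricSpace Z]
    (h : IsDoublingSpace Z) : ∃ m, CapacityDimProperty Z m := by
  obtain ⟨Q, hQ⟩ := h.exists_local_coloring 5
  refine ⟨Q, 1 / 8, by norm_num, 1, one_pos, fun τ hτ _ => ?_⟩
  obtain ⟨χ, hχ⟩ := hQ (τ / 4) (by positivity)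
  -- the classes of points of equal color at distance at most `τ / 2`
  let K : Z → Set Z := fun z => {w | χ w = χ z ∧ dist w z ≤ τ / 2}
  have hKK : ∀ z z' x x', χ z = χ z' → x ∈ K z → x' ∈ K z' → dist x x' < τ / 4 → K z = K z' := by
    intro z z' x x' hc hx hx' hd
    have hzz : dist z z' ≤ τ / 2 := by
      have := hχ x z' (hx.1.trans hc) (by
        have := dist_triangle x x' z'
        linarith [hx'.2])
      have := hχ z z' hc (by
        have := dist_triangle_left z z' x
        linarith [hx.2])
      linarith
    ext w
    simp only [K, Set.mem_ofPred_eq, hc, and_congr_right_iff]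
    intro hw
    constructor
    · intro hwz
      have := hχ w z' hw (by
        have := dist_triangle w z z'
        linarith)
      linarith
    · intro hwz
      have := hχ w z (hw.trans hc.symm) (by
        have := dist_triangle_right w z z'
        linarith)
      linarith
  have hsub : ∀ z, Metric.ball z (τ / 8) ⊆ Metric.thickening (τ / 8) (K z) := fun z w hw =>
    Metric.mem_thickening_iff.2 ⟨z, ⟨rfl, by rw [dist_self]; positivity⟩, hw⟩
  refine ⟨fun c => {U | ∃ z, χ z = c ∧ U = Metric.thickening (τ / 8) (K z)}, ⟨?_, ?_, ?_⟩, ?_, ?_⟩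
  · rintro c U ⟨z, -, rfl⟩
    exact Metric.isOpen_thickening
  · rintro c U ⟨z, hz, rfl⟩ U' ⟨z', hz', rfl⟩ hne
    refine Set.disjoint_left.2 fun w hw hw' => hne ?_
    obtain ⟨x, hx, hwx⟩ := Metric.mem_thickening_iff.1 hw
    obtain ⟨x', hx', hwx'⟩ := Metric.mem_thickening_iff.1 hw'
    rw [hKK z z' x x' (hz.trans hz'.symm) hx hx' (by
      have := dist_triangle_left x x' w
      linarith)]
  · refine Set.eq_univ_iff_forall.2 fun z => ⟨_, Set.mem_iUnion.2 ⟨χ z, z, rfl, rfl⟩, ?_⟩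
    exact hsub z (Metric.mem_ball_self (by positivity))
  · refine iSup₂_le fun U hU => ?_
    obtain ⟨c, z, -, rfl⟩ := Set.mem_iUnion.1 hU
    refine Metric.ediam_le fun x hx y hy => ?_
    obtain ⟨x', hx', hxx'⟩ := Metric.mem_thickening_iff.1 hx
    obtain ⟨y', hy', hyy'⟩ := Metric.mem_thickening_iff.1 hy
    rw [edist_dist]
    refine ENNReal.ofReal_le_ofReal ?_
    have h1 := hχ x' y' (hx'.1.trans hy'.1.symm) (by
      have := dist_triangle_right x' y' z
      linarith [hx'.2, hy'.2])
    have h2 := dist_triangle4 x x' y' y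
    rw [dist_comm y y'] at hyy'
    linarith
  · refine le_iInf fun z => ?_
    refine le_trans ?_ (le_iSup₂ (f := fun U _ => Metric.infEDist z Uᶜ)
      (Metric.thickening (τ / 8) (K z)) (Set.mem_iUnion.2 ⟨χ z, z, rfl, rfl⟩))
    refine Metric.le_infEDist.2 fun w hw => ?_
    rw [edist_dist]
    refine ENNReal.ofReal_le_ofReal ?_
    by_contra! hlt
    refine hw (hsub z ?_)
    rw [Metric.mem_ball, dist_comm]
    linarith

theorem exists_capacityDim_eq {Z : Type*} [MetricSpace Z] (h : ∃ m, CapacityDimProperty Z m) :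
    ∃ n : ℕ, capacityDim Z = (n : ℕ∞) ∧ CapacityDimProperty Z n := by
  classical
  refine ⟨Nat.find h, le_antisymm (iInf₂_le _ (Nat.find_spec h)) ?_, Nat.find_spec h⟩
  exact le_iInf₂ fun m hm => by exact_mod_cast Nat.find_min' h hm

/-! ### Laminar families of rooms -/

/-- For a family of cores `𝒞 i` on the levels `i`, the points of the room `V` (flag `false`) and of
the hull `T` (flag `true`) of a core `U` of level `i`. The room absorbs the hulls of finer cores
that meet `U`; the hull contains the `ρ i`-neighbourhood of the room and absorbs the hulls of finer
cores that meet this neighbourhood. -/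
inductive RoomPoint {Z : Type*} [MetricSpace Z] (𝒞 : ℕ → Set (Set Z)) (ρ : ℕ → ℝ) :
    Bool → ℕ → Set Z → Z → Prop
  | core {i : ℕ} {U : Set Z} {x : Z} : U ∈ 𝒞 i → x ∈ U → RoomPoint 𝒞 ρ false i U x
  | absorbCore {i j : ℕ} {U W : Set Z} {x y : Z} : U ∈ 𝒞 i → i < j → x ∈ U →
      RoomPoint 𝒞 ρ true j W x → RoomPoint 𝒞 ρ true j W y → RoomPoint 𝒞 ρ false i U y
  | thicken {i : ℕ} {U : Set Z} {x y : Z} : RoomPoint 𝒞 ρ false i U x → dist x y < ρ i →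
      RoomPoint 𝒞 ρ true i U y
  | absorb {i j : ℕ} {U W : Set Z} {x w y : Z} : RoomPoint 𝒞 ρ false i U x → dist x w < ρ i →
      i < j → RoomPoint 𝒞 ρ true j W w → RoomPoint 𝒞 ρ true j W y → RoomPoint 𝒞 ρ true i U y

/-- Cores of level `i` have diameter at most `σ i` and distinct ones are separated by `8 s σ i`;
the scales `σ i` decrease fast compared with `s`. -/
structure IsCoreSystem {Z : Type*} [MetricSpace Z] (𝒞 : ℕ → Set (Set Z)) (s : ℝ) (σ : ℕ → ℝ) :
    Prop where
  s_pos : 0 < s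
  s_le : s ≤ 1 / 4
  σ_pos : ∀ i, 0 < σ i
  σ_succ : ∀ i, σ (i + 1) = s / 4 * σ i
  diam_le : ∀ i, ∀ U ∈ 𝒞 i, ∀ x ∈ U, ∀ y ∈ U, dist x y ≤ σ i
  separated : ∀ i, ∀ U ∈ 𝒞 i, ∀ W ∈ 𝒞 i, ∀ x ∈ U, ∀ y ∈ W, dist x y < 8 * s * σ i → U = W

namespace IsCoreSystem

variable {Z : Type*} [MetricSpace Z] {𝒞 : ℕ → Set (Set Z)} {s : ℝ} {σ : ℕ → ℝ}

theorem σ_anti (h : IsCoreSystem 𝒞 s σ) : Antitone σ := by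
  refine antitone_nat_of_succ_le fun i => ?_
  rw [h.σ_succ]
  have := h.σ_pos i
  have := h.s_le
  nlinarith

theorem σ_le_of_lt (h : IsCoreSystem 𝒞 s σ) {i j : ℕ} (hij : i < j) : σ j ≤ s / 4 * σ i :=
  (h.σ_anti hij).trans_eq (h.σ_succ i)

/-- Rooms and hulls stay near their cores because absorption happens only at finer levels: an
absorbed hull of level `j > i` has diameter at most `(1 + 4 s) σ j ≤ 2 σ j ≤ s / 2 * σ i`. A hull
adds to the `s / 2` of its room at most `s` for the thickening and `s / 2` for one more absorbed
hull. -/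
theorem bound (h : IsCoreSystem 𝒞 s σ) {b : Bool} {i : ℕ} {U : Set Z} {y : Z}
    (hy : RoomPoint 𝒞 (fun i => s * σ i) b i U y) :
    U ∈ 𝒞 i ∧ ∃ x ∈ U, dist x y ≤ (if b then 2 * s else s / 2) * σ i := by
  have hs := h.s_pos
  have hs' := h.s_le
  have crossing : ∀ {i j : ℕ} {W : Set Z} {x y : Z}, i < j →
      (W ∈ 𝒞 j ∧ ∃ w ∈ W, dist w x ≤ 2 * s * σ j) → (W ∈ 𝒞 j ∧ ∃ w ∈ W, dist w y ≤ 2 * s * σ j) →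
      dist x y ≤ s / 2 * σ i := by
    rintro i j W x y hij ⟨hW, w, hw, hwx⟩ ⟨-, w', hw', hwy⟩
    have h1 := dist_triangle4 x w w' y
    rw [dist_comm x w] at h1
    have h2 := h.diam_le j W hW w hw w' hw'
    have h3 := h.σ_le_of_lt hij
    have h4 := h.σ_pos j
    nlinarith
  induction hy with
  | core hU hx =>
    refine ⟨hU, _, hx, ?_⟩
    rw [dist_self]
    have := h.σ_pos
    simp only [Bool.false_eq_true, if_false]
    exact mul_nonneg (by linarith) (this _).le
  | absorbCore hU hij hx _ _ ihx ihy =>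
    simp only [if_true] at ihx ihy
    exact ⟨hU, _, hx, by simpa using crossing hij ihx ihy⟩
  | @thicken i U x y _ hd ih =>
    obtain ⟨hU, u, hu, hux⟩ := ih
    refine ⟨hU, u, hu, ?_⟩
    simp only [Bool.false_eq_true, if_false, if_true] at hux ⊢
    have := dist_triangle u x y
    have := h.σ_pos i
    nlinarith
  | @absorb i j U W x w y _ hd hij _ _ ih ihw ihy =>
    obtain ⟨hU, u, hu, hux⟩ := ih
    refine ⟨hU, u, hu, ?_⟩
    simp only [Bool.false_eq_true, if_false, if_true] at hux ihw ihy ⊢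
    have h1 := crossing hij ihw ihy
    have := dist_triangle4 u x w y
    nlinarith

theorem eq_of_hull_inter (h : IsCoreSystem 𝒞 s σ) {i : ℕ} {U W : Set Z} {z : Z}
    (hU : RoomPoint 𝒞 (fun i => s * σ i) true i U z)
    (hW : RoomPoint 𝒞 (fun i => s * σ i) true i W z) : U = W := by
  obtain ⟨hU', x, hx, hxz⟩ := h.bound hU
  obtain ⟨hW', y, hy, hyz⟩ := h.bound hW
  refine h.separated i U hU' W hW' x hx y hy ?_
  simp only [if_true] at hxz hyz
  have := dist_triangle_right x y z
  have := mul_pos h.s_pos (h.σ_pos i)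
  nlinarith

/-- Of two hulls that meet, the coarser contains the finer. If `z` lies in the thickened room of the
coarser hull, that hull absorbs the finer one by definition. Otherwise `z` lies in an absorbed hull,
which is compared with the finer one by induction: it is either coarser and swallows it, or the
same, or finer and contained in it, in which case the finer of the two original hulls meets the
thickened room itself. The equation `b = true` keeps the flag general for the induction. -/
theorem hull_trichotomy (h : IsCoreSystem 𝒞 s σ) {b : Bool} {i : ℕ} {U : Set Z} {z : Z}
    (hU : RoomPoint 𝒞 (fun i => s * σ i) b i U z) (hb : b = true) {j : ℕ} {W : Set Z}
    (hW : RoomPoint 𝒞 (fun i => s * σ i) true j W z) :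
    (i < j → ∀ y, RoomPoint 𝒞 (fun i => s * σ i) true j W y →
      RoomPoint 𝒞 (fun i => s * σ i) true i U y) ∧
    (j < i → ∀ y, RoomPoint 𝒞 (fun i => s * σ i) true i U y →
      RoomPoint 𝒞 (fun i => s * σ i) true j W y) ∧ (i = j → U = W) := by
  -- the inclusion of finer hulls, which uses the trichotomy for the absorbed hulls
  have upward : ∀ {b : Bool} {i : ℕ} {U : Set Z} {z : Z},
      RoomPoint 𝒞 (fun i => s * σ i) b i U z → b = true →
      (∀ {j : ℕ} {W : Set Z}, RoomPoint 𝒞 (fun i => s * σ i) true j W z → i < j →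
        ∀ y, RoomPoint 𝒞 (fun i => s * σ i) true j W y →
          RoomPoint 𝒞 (fun i => s * σ i) true i U y) →
      ∀ {b' : Bool} {j : ℕ} {W : Set Z}, RoomPoint 𝒞 (fun i => s * σ i) b' j W z → b' = true →
        j < i → ∀ y, RoomPoint 𝒞 (fun i => s * σ i) true i U y →
          RoomPoint 𝒞 (fun i => s * σ i) true j W y := by
    intro b i U z hU hb hup b' j W hW
    subst hb
    induction hW with
    | core => intro hb'; cases hb'
    | absorbCore => intro hb'; cases hb'
    | thicken hx hd _ => exact fun _ hji y hy => .absorb hx hd hji hU hy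
    | @absorb j j' W W' x w z hx hd hjj' hw hz _ _ ihz =>
      intro _ hji y hy
      rcases lt_trichotomy j' i with hlt | rfl | hgt
      · exact .absorb hx hd hjj' hw (ihz hup hU rfl hlt y hy)
      · obtain rfl := h.eq_of_hull_inter hU hz
        exact .absorb hx hd hjj' hw hy
      · exact .absorb hx hd hji (hup hz hgt w hw) hy
  have downward : ∀ {b : Bool} {i : ℕ} {U : Set Z} {z : Z},
      RoomPoint 𝒞 (fun i => s * σ i) b i U z → b = true →
      ∀ {j : ℕ} {W : Set Z}, RoomPoint 𝒞 (fun i => s * σ i) true j W z → i < j →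
        ∀ y, RoomPoint 𝒞 (fun i => s * σ i) true j W y →
          RoomPoint 𝒞 (fun i => s * σ i) true i U y := by
    intro b i U z hU
    induction hU with
    | core => intro hb'; cases hb'
    | absorbCore => intro hb'; cases hb'
    | thicken hx hd _ => exact fun _ j W hW hij y hy => .absorb hx hd hij hW hy
    | @absorb i i' U U' x w z hx hd hii' hw hz _ _ ihz =>
      intro _ j W hW hij y hy
      rcases lt_trichotomy i' j with hlt | rfl | hgt
      · exact .absorb hx hd hii' hw (ihz rfl hW hlt y hy)
      · obtain rfl := h.eq_of_hull_inter hW hz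
        exact .absorb hx hd hii' hw hy
      · exact .absorb hx hd hij (upward hz rfl (ihz rfl) hW rfl hgt w hw) hy
  refine ⟨downward hU hb hW, upward hU hb (downward hU hb) hW rfl, ?_⟩
  rintro rfl
  subst hb
  exact h.eq_of_hull_inter hU hW

/-- The only doubtful case is a point `z` in an absorbed hull finer than that of `W`. By
`hull_trichotomy` the hull of `W` then contains it, so it meets the core of `U` and is absorbed too.
-/
theorem room_of_hull (h : IsCoreSystem 𝒞 s σ) {i j : ℕ} {U W : Set Z} {z y : Z} (hij : i < j)
    (hU : RoomPoint 𝒞 (fun i => s * σ i) false i U z)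
    (hW : RoomPoint 𝒞 (fun i => s * σ i) true j W z)
    (hy : RoomPoint 𝒞 (fun i => s * σ i) true j W y) :
    RoomPoint 𝒞 (fun i => s * σ i) false i U y := by
  cases hU with
  | core hU hz => exact .absorbCore hU hij hz hW hy
  | @absorbCore _ j' _ W' x _ hU hij' hx hWx hWz =>
    obtain ⟨h1, h2, h3⟩ := h.hull_trichotomy hWz rfl hW
    rcases lt_trichotomy j' j with hlt | rfl | hgt
    · exact .absorbCore hU hij' hx hWx (h1 hlt y hy)
    · obtain rfl := h3 rfl
      exact .absorbCore hU hij' hx hWx hy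
    · exact .absorbCore hU hij hx (h2 hgt x hWx) hy

end IsCoreSystem

/-- Families of rooms `V` of the levels `i`: rooms of one level are disjoint, and a room of a finer
level `j` that meets a room lies in it together with its `s σ j`-neighbourhood. -/
structure IsLaminar {Z : Type*} [MetricSpace Z] (𝒱 : ℕ → Set (Set Z)) (s : ℝ) (σ : ℕ → ℝ) :
    Prop where
  diam_le : ∀ i, ∀ V ∈ 𝒱 i, ∀ x ∈ V, ∀ y ∈ V, dist x y ≤ 2 * σ i
  eq_of_mem : ∀ i, ∀ V ∈ 𝒱 i, ∀ W ∈ 𝒱 i, ∀ x ∈ V, x ∈ W → V = W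
  mem_of_near : ∀ i j, i < j → ∀ V ∈ 𝒱 i, ∀ W ∈ 𝒱 j, ∀ x ∈ V, x ∈ W →
    ∀ y ∈ W, ∀ z, dist y z < s * σ j → z ∈ V

theorem IsCoreSystem.exists_laminar {Z : Type*} [MetricSpace Z] {𝒞 : ℕ → Set (Set Z)} {s : ℝ}
    {σ : ℕ → ℝ} (h : IsCoreSystem 𝒞 s σ) :
    ∃ 𝒱 : ℕ → Set (Set Z), IsLaminar 𝒱 s σ ∧ ∀ i, ∀ U ∈ 𝒞 i, ∃ V ∈ 𝒱 i, U ⊆ V := by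
  have hthick : ∀ {i : ℕ} {U : Set Z} {z : Z}, RoomPoint 𝒞 (fun i => s * σ i) false i U z →
      RoomPoint 𝒞 (fun i => s * σ i) true i U z := fun {i U z} hz =>
    .thicken hz (by rw [dist_self]; exact mul_pos h.s_pos (h.σ_pos i))
  refine ⟨fun i => {V | ∃ U ∈ 𝒞 i, V = {z | RoomPoint 𝒞 (fun i => s * σ i) false i U z}},
    ⟨?_, ?_, ?_⟩, fun i U hU => ⟨_, ⟨U, hU, rfl⟩, fun x hx => .core hU hx⟩⟩
  · rintro i _ ⟨U, hU, rfl⟩ x hx y hy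
    obtain ⟨-, u, hu, hux⟩ := h.bound hx
    obtain ⟨-, v, hv, hvy⟩ := h.bound hy
    simp only [Bool.false_eq_true, if_false] at hux hvy
    have h1 := dist_triangle4 x u v y
    rw [dist_comm x u] at h1
    have h2 := h.diam_le i U hU u hu v hv
    have h3 := h.σ_pos i
    have h4 := h.s_le
    nlinarith
  · rintro i _ ⟨U, hU, rfl⟩ _ ⟨W, hW, rfl⟩ x hx hx'
    rw [h.eq_of_hull_inter (hthick hx) (hthick hx')]
  · rintro i j hij _ ⟨U, hU, rfl⟩ _ ⟨W, hW, rfl⟩ x hx hx' y hy z hyz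
    exact h.room_of_hull hij hx (hthick hx') (.thicken hy hyz)

/-- The core of a member `U` consists of the points whose ball of radius `8 s σ i` lies in `U`;
disjointness of the members of one color separates these cores. The Lebesgue number exceeds `16 s σ
i`, so each ball of radius `s σ i` lies in a core, hence in a room. Level `0` is left out because
its scale `τ₀` is not below `τ₀`. -/
theorem CapacityDimProperty.exists_laminar {Z : Type*} [MetricSpace Z] {n : ℕ}
    (h : CapacityDimProperty Z n) :
    ∃ (s κ : ℝ), 0 < s ∧ s ≤ 1 / 4 ∧ 0 < κ ∧ ∃ 𝒱 : Fin (n + 1) → ℕ → Set (Set Z),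
      (∀ c, IsLaminar (𝒱 c) s fun i => κ * (s / 4) ^ i) ∧
      ∀ i, 1 ≤ i → ∀ z, ∃ c, ∃ V ∈ 𝒱 c i, Metric.ball z (s * (κ * (s / 4) ^ i)) ⊆ V := by
  obtain ⟨δ, hδ, τ₀, hτ₀, H⟩ := h
  set s : ℝ := min δ 1 / 32 with hs
  have hs0 : 0 < s := by have := lt_min hδ one_pos; positivity
  have hsδ : 32 * s ≤ δ := by rw [hs]; linarith [min_le_left δ 1]
  have hs1 : 32 * s ≤ 1 := by rw [hs]; linarith [min_le_right δ 1]
  set σ : ℕ → ℝ := fun i => τ₀ * (s / 4) ^ i with hσ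
  have hσ0 : ∀ i, 0 < σ i := fun i => by positivity
  have hσlt : ∀ i, 1 ≤ i → σ i < τ₀ := by
    intro i hi
    have : (s / 4) ^ i < 1 := pow_lt_one₀ (by positivity) (by linarith) (by omega)
    simp only [hσ]
    nlinarith
  have H' : ∀ i, ∃ 𝒰 : Fin (n + 1) → Set (Set Z), 1 ≤ i → IsColoredOpenCovering 𝒰 ∧
      mesh (⋃ c, 𝒰 c) ≤ ENNReal.ofReal (σ i) ∧
      ENNReal.ofReal (δ * σ i) ≤ lebesgueNumber (⋃ c, 𝒰 c) := by
    intro i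
    by_cases hi : 1 ≤ i
    · obtain ⟨𝒰, h𝒰⟩ := H (σ i) (hσ0 i) (hσlt i hi)
      exact ⟨𝒰, fun _ => h𝒰⟩
    · exact ⟨fun _ => ∅, fun h => absurd h hi⟩
  choose 𝒰 h𝒰 using H'
  let 𝒞 : Fin (n + 1) → ℕ → Set (Set Z) := fun c i =>
    {A | 1 ≤ i ∧ ∃ U ∈ 𝒰 i c, A = {z | Metric.ball z (8 * s * σ i) ⊆ U}}
  have hpos : ∀ i, 0 < 8 * s * σ i := fun i => mul_pos (by linarith) (hσ0 i)
  have hcore : ∀ c, IsCoreSystem (𝒞 c) s σ := by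
    intro c
    refine ⟨hs0, by linarith, hσ0, fun i => ?_, ?_, ?_⟩
    · simp only [hσ, pow_succ]
      ring
    · rintro i _ ⟨hi, U, hU, rfl⟩ x hx y hy
      have h1 : edist x y ≤ Metric.ediam U := Metric.edist_le_ediam_of_mem
        (hx (Metric.mem_ball_self (hpos i))) (hy (Metric.mem_ball_self (hpos i)))
      have h2 : Metric.ediam U ≤ mesh (⋃ c, 𝒰 i c) :=
        le_iSup₂ (f := fun U _ => Metric.ediam U) U (Set.mem_iUnion.2 ⟨c, hU⟩)
      have h3 := (h1.trans h2).trans (h𝒰 i hi).2.1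
      rw [edist_dist] at h3
      exact (ENNReal.ofReal_le_ofReal_iff (hσ0 i).le).1 h3
    · rintro i _ ⟨hi, U, hU, rfl⟩ _ ⟨-, W, hW, rfl⟩ x hx y hy hd
      by_contra hne
      have hUW : U ≠ W := by
        rintro rfl
        exact hne rfl
      have hyU : y ∈ U := hx (by rwa [Metric.mem_ball, dist_comm])
      exact Set.disjoint_left.1 ((h𝒰 i hi).1.disjoint c hU hW hUW) hyU
        (hy (Metric.mem_ball_self (hpos i)))
  choose 𝒱 h𝒱 h𝒞𝒱 using fun c => (hcore c).exists_laminar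
  refine ⟨s, τ₀, hs0, by linarith, hτ₀, 𝒱, h𝒱, fun i hi z => ?_⟩
  have hleb : ENNReal.ofReal (16 * s * σ i) < ⨆ U ∈ ⋃ c, 𝒰 i c, Metric.infEDist z Uᶜ := by
    refine lt_of_lt_of_le ?_ (((h𝒰 i hi).2.2).trans (iInf_le _ z))
    rw [ENNReal.ofReal_lt_ofReal_iff (mul_pos hδ (hσ0 i))]
    have := hσ0 i
    nlinarith
  obtain ⟨U, hU⟩ := lt_iSup_iff.1 hleb
  obtain ⟨hUm, hU⟩ := lt_iSup_iff.1 hU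
  obtain ⟨c, hUc⟩ := Set.mem_iUnion.1 hUm
  obtain ⟨V, hV, hsub⟩ := h𝒞𝒱 c i _ ⟨hi, U, hUc, rfl⟩
  refine ⟨c, V, hV, fun y hy => hsub fun w hw => ?_⟩
  by_contra hwU
  have h1 : Metric.infEDist z Uᶜ ≤ edist z w := Metric.infEDist_le_edist_of_mem hwU
  have h2 := hU.trans_le h1
  rw [edist_dist, ENNReal.ofReal_lt_ofReal_iff_of_nonneg
    (mul_pos (by linarith) (hσ0 i)).le] at h2
  have h3 := dist_triangle_left z w y
  rw [Metric.mem_ball] at hy hw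
  rw [dist_comm] at hw
  have h4 : s * σ i ≤ 8 * s * σ i := by have := mul_pos hs0 (hσ0 i); linarith
  have h5 : dist y z < s * σ i := hy
  linarith

/-! ### Words in the binary metric tree -/

theorem treeVertex_apply (u t : List (Fin 3)) :
    (treeVertex u : List (Fin 3) → ℝ) t = if t ≠ [] ∧ t <:+ u then 1 else 0 := by
  induction u with
  | nil =>
    rw [if_neg fun h => h.1 (List.suffix_nil.1 h.2)]
    rfl
  | cons a w ih =>
    have hadd : (treeVertex (a :: w) : List (Fin 3) → ℝ) t =
        (treeVertex w : List (Fin 3) → ℝ) t +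
          (lp.single 1 (a :: w) (1 : ℝ) : lp (fun _ : List (Fin 3) => ℝ) 1) t := rfl
    rw [hadd, ih]
    by_cases ht : t = a :: w
    · subst ht
      have h1 : ¬ (a :: w) <:+ w := fun h => by
        have := h.length_le
        simp at this
      rw [if_neg fun h => h1 h.2, if_pos ⟨List.cons_ne_nil _ _, List.suffix_refl _⟩, lp.single_apply]
      simp
    · rw [lp.single_apply, Pi.single_eq_of_ne ht, add_zero]
      simp only [List.suffix_cons_iff, ht, false_or]

theorem dist_treeVertex_append_le (p u : List (Fin 3)) :
    dist (treeVertex (p ++ u)) (treeVertex u) ≤ p.length := by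
  induction p with
  | nil => simp
  | cons a p ih =>
    have h1 : dist (treeVertex (a :: (p ++ u))) (treeVertex (p ++ u)) ≤ 1 := by
      rw [dist_eq_norm, treeVertex, add_sub_cancel_left, lp.norm_single (by norm_num)]
      simp
    have h2 := dist_triangle (treeVertex (a :: (p ++ u))) (treeVertex (p ++ u)) (treeVertex u)
    simp only [List.cons_append, List.length_cons, Nat.cast_add, Nat.cast_one]
    linarith

/-- The suffixes of `u` longer than `q` label edges on the path to `u` but not on the path to `v`,
and each adds `1` to the `ℓ¹` distance. -/
theorem le_dist_treeVertex {u v : List (Fin 3)} {q : ℕ} (hq : q ≤ u.length)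
    (h : ¬ u.drop (u.length - q) <:+ v) :
    ((u.length - q : ℕ) : ℝ) ≤ dist (treeVertex u) (treeVertex v) := by
  classical
  have hinj : Set.InjOn (fun i => u.drop i) (Finset.range (u.length - q) : Set ℕ) := by
    intro i hi j hj hij
    simp only [Finset.coe_range, Set.mem_Iio] at hi hj
    have := congrArg List.length hij
    simp only [List.length_drop] at this
    omega
  have hsum := lp.sum_rpow_le_norm_rpow (p := 1) (by norm_num) (treeVertex u - treeVertex v)
    ((Finset.range (u.length - q)).image fun i => u.drop i)
  rw [Finset.sum_image hinj] at hsum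
  simp only [ENNReal.toReal_one, Real.rpow_one] at hsum
  rw [dist_eq_norm]
  refine le_trans (le_of_eq ?_) hsum
  rw [Finset.sum_congr rfl (g := fun _ => (1 : ℝ)) ?_]
  · simp
  · intro i hi
    rw [Finset.mem_range] at hi
    have hsub : ((treeVertex u - treeVertex v : lp (fun _ : List (Fin 3) => ℝ) 1) :
        List (Fin 3) → ℝ) (u.drop i) = (treeVertex u : List (Fin 3) → ℝ) (u.drop i) -
          (treeVertex v : List (Fin 3) → ℝ) (u.drop i) := rfl
    rw [hsub, treeVertex_apply, treeVertex_apply, if_pos, if_neg]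
    · simp
    · rintro ⟨-, hv⟩
      refine h (List.IsSuffix.trans ?_ hv)
      have : u.drop (u.length - q) = (u.drop i).drop (u.length - q - i) := by
        rw [List.drop_drop]
        congr 1
        omega
      rw [this]
      exact List.drop_suffix _ _
    · refine ⟨fun h0 => ?_, List.drop_suffix _ _⟩
      rw [List.drop_eq_nil_iff] at h0
      omega

/-- The vertex of a reduced word, as a point of the binary metric tree. -/
noncomputable def treePoint (u : List (Fin 3)) (hu : u.IsChain (· ≠ ·)) : BinaryMetricTree :=
  ⟨treeVertex u, by
    cases u with
    | nil => exact ⟨0, [], by simp, left_mem_segment ℝ _ _⟩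
    | cons a w => exact ⟨a, w, hu, right_mem_segment ℝ _ _⟩⟩

theorem dist_treePoint {u v : List (Fin 3)} (hu : u.IsChain (· ≠ ·)) (hv : v.IsChain (· ≠ ·)) :
    dist (treePoint u hu) (treePoint v hv) = dist (treeVertex u) (treeVertex v) := rfl

/-- The code of a word of bits by a reduced word. -/
def bitCode (l : List Bool) : List (Fin 3) := l.flatMap fun b => [0, if b then 2 else 1]

theorem isChain_bitCode (l : List Bool) : (bitCode l).IsChain (· ≠ ·) := by
  induction l with
  | nil => simp [bitCode]
  | cons b l ih =>
    have h2 : (if b then 2 else 1 : Fin 3) ≠ 0 := by cases b <;> decide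
    cases l with
    | nil => simpa [bitCode] using h2.symm
    | cons b' l =>
      simp only [bitCode, List.flatMap_cons, List.cons_append, List.nil_append,
        List.isChain_cons_cons] at ih ⊢
      exact ⟨h2.symm, h2, ih⟩

theorem length_flatMap_const {α β : Type*} (f : α → List β) {m : ℕ} (hf : ∀ a, (f a).length = m)
    (l : List α) : (l.flatMap f).length = m * l.length := by
  induction l with
  | nil => simp
  | cons a l ih =>
    rw [List.flatMap_cons, List.length_append, ih, hf, List.length_cons]
    ring

theorem flatMap_const_injective {α β : Type*} {f : α → List β} {m : ℕ}
    (hf : ∀ a, (f a).length = m) (hinj : Function.Injective f) {l l' : List α}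
    (hlen : l.length = l'.length) (h : l.flatMap f = l'.flatMap f) : l = l' := by
  induction l generalizing l' with
  | nil => exact (List.length_eq_zero_iff.1 hlen.symm).symm
  | cons a l ih =>
    cases l' with
    | nil => simp at hlen
    | cons a' l' =>
      rw [List.flatMap_cons, List.flatMap_cons] at h
      obtain ⟨h1, h2⟩ := List.append_inj h ((hf a).trans (hf a').symm)
      rw [hinj h1, ih (by simpa using hlen) h2]

theorem suffix_of_flatMap_suffix {α β : Type*} {f : α → List β} {m : ℕ} (hm : 0 < m)
    (hf : ∀ a, (f a).length = m) (hinj : Function.Injective f) {l l' : List α}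
    (h : l.flatMap f <:+ l'.flatMap f) : l <:+ l' := by
  have hlen : l.length ≤ l'.length := by
    have := h.length_le
    rw [length_flatMap_const f hf, length_flatMap_const f hf] at this
    exact Nat.le_of_mul_le_mul_left this hm
  have hsplit : l'.flatMap f = (l'.take (l'.length - l.length)).flatMap f ++
      (l'.drop (l'.length - l.length)).flatMap f := by
    rw [← List.flatMap_append, List.take_append_drop]
  have h1 : (l'.drop (l'.length - l.length)).flatMap f <:+ l'.flatMap f := ⟨_, hsplit.symm⟩
  have hl : l.length = (l'.drop (l'.length - l.length)).length := by
    rw [List.length_drop]; omega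
  have h2 : l.flatMap f = (l'.drop (l'.length - l.length)).flatMap f := by
    have h3 := List.suffix_of_suffix_length_le h h1 (by
      rw [length_flatMap_const f hf, length_flatMap_const f hf, ← hl])
    refine h3.eq_of_length ?_
    rw [length_flatMap_const f hf, length_flatMap_const f hf, ← hl]
  rw [flatMap_const_injective hf hinj hl h2]
  exact List.drop_suffix _ _

/-- Words over a finite alphabet are coded in the binary metric tree, up to constants with the
distances of the tree of words. -/
theorem exists_tree_coding (α : Type*) [Finite α] :
    ∃ (g : List α → BinaryMetricTree) (b : ℝ), 0 < b ∧
      (∀ p p' t, dist (g (p ++ t)) (g (p' ++ t)) ≤ b * (p.length + p'.length)) ∧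
      ∀ w w' q, q ≤ w.length → ¬ w.drop (w.length - q) <:+ w' →
        ((w.length - q : ℕ) : ℝ) ≤ dist (g w) (g w') := by
  classical
  obtain ⟨M, ⟨e⟩⟩ := Finite.exists_equiv_fin α
  -- A letter becomes its indicator vector in bits; the leading bit keeps the common length positive
  -- even for an empty alphabet.
  let f : α → List (Fin 3) := fun a =>
    bitCode (true :: (List.finRange M).map fun i => decide (e a = i))
  have hf : ∀ a, (f a).length = 2 * (M + 1) := fun a => by
    refine (length_flatMap_const _ (m := 2) (fun b => rfl) _).trans ?_
    simp
  have hinj : Function.Injective f := by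
    intro a a' h
    have h1 := flatMap_const_injective (m := 2) (fun b => rfl) (by decide) (by simp) h
    have h2 := (List.cons.inj h1).2
    rw [List.map_inj_left] at h2
    have := h2 (e a) (List.mem_finRange _)
    simp only [decide_true, true_eq_decide_iff] at this
    exact (e.injective this).symm
  have hchain : ∀ w : List α, (w.flatMap f).IsChain (· ≠ ·) := by
    intro w
    have : w.flatMap f =
        bitCode (w.flatMap fun a => true :: (List.finRange M).map fun i => decide (e a = i)) := by
      simp only [bitCode, f, List.flatMap_assoc]
    rw [this]
    exact isChain_bitCode _
  refine ⟨fun w => treePoint (w.flatMap f) (hchain w), (2 * (M + 1) : ℕ), by positivity, ?_, ?_⟩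
  · intro p p' t
    rw [dist_treePoint, List.flatMap_append, List.flatMap_append]
    have h1 := dist_treeVertex_append_le (p.flatMap f) (t.flatMap f)
    have h2 := dist_treeVertex_append_le (p'.flatMap f) (t.flatMap f)
    have h3 := dist_triangle_right (treeVertex (p.flatMap f ++ t.flatMap f))
      (treeVertex (p'.flatMap f ++ t.flatMap f)) (treeVertex (t.flatMap f))
    rw [length_flatMap_const f hf] at h1 h2
    push_cast at h1 h2 ⊢
    linarith
  · intro w w' q hq hsuf
    rw [dist_treePoint]
    have hlen := length_flatMap_const f hf w
    have hq' : 2 * (M + 1) * q ≤ (w.flatMap f).length := by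
      rw [hlen]
      exact Nat.mul_le_mul_left _ hq
    refine le_trans ?_ (le_dist_treeVertex hq' ?_)
    · rw [hlen, ← Nat.mul_sub]
      exact_mod_cast Nat.le_mul_of_pos_left _ (by omega)
    · intro hs
      refine hsuf (suffix_of_flatMap_suffix (by omega) hf hinj (List.IsSuffix.trans ?_ hs))
      have h1 : (w.drop (w.length - q)).flatMap f <:+ w.flatMap f :=
        ⟨(w.take (w.length - q)).flatMap f, by rw [← List.flatMap_append, List.take_append_drop]⟩
      refine List.suffix_of_suffix_length_le h1 (List.drop_suffix _ _) ?_
      rw [length_flatMap_const f hf, List.length_drop, List.length_drop, hlen]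
      refine le_of_eq ?_
      rw [← Nat.mul_sub, ← Nat.mul_sub]

/-! ### The diary

A diary is kept over a sequence of batches of entries, newest batch first. Entries not yet written
are kept on a stack; with each batch the topmost `Λ` entries are written and removed. The last (that
is, oldest) entry of a batch carries the flag `true`, the others the flag `false`. -/

/-- The entries that are not yet written. -/
def diaryStack {α : Type*} (Λ : ℕ) : List (List α) → List α
  | [] => []
  | B :: T => (B ++ diaryStack Λ T).drop Λ

/-- The diary: one letter, a list of at most `Λ` entries, for each batch. -/
def diary {α : Type*} (Λ : ℕ) : List (List α) → List {l : List α // l.length ≤ Λ}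
  | [] => []
  | B :: T => ⟨(B ++ diaryStack Λ T).take Λ, List.length_take_le _ _⟩ :: diary Λ T

theorem length_diary {α : Type*} (Λ : ℕ) (Bs : List (List α)) :
    (diary Λ Bs).length = Bs.length := by
  induction Bs with
  | nil => rfl
  | cons B T ih => simp [diary, ih]

/-- A letter depends only on its own batch and the older ones. Hence histories with a common
beginning have diaries with a common suffix, and branch in the tree accordingly. -/
theorem drop_diary {α : Type*} (Λ : ℕ) (Bs : List (List α)) (n : ℕ) :
    (diary Λ Bs).drop n = diary Λ (Bs.drop n) := by
  induction Bs generalizing n with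
  | nil => simp [diary]
  | cons B T ih =>
    cases n with
    | zero => rfl
    | succ n => simpa [diary] using ih n

/-- A batch: a nonempty list of flagged entries in which exactly the last entry has the flag. -/
def IsBatch {β : Type*} (B : List (β × Bool)) : Prop :=
  ∃ (l : List (β × Bool)) (b : β), (∀ e ∈ l, e.2 = false) ∧ B = l ++ [(b, true)]

/-- The flag on the last entry makes batches a prefix code. -/
theorem IsBatch.eq_of_append_eq {β : Type*} {B B' X X' : List (β × Bool)} (hB : IsBatch B)
    (hB' : IsBatch B') (h : B ++ X = B' ++ X') : B = B' := by
  obtain ⟨l, b, hl, rfl⟩ := hB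
  obtain ⟨l', b', hl', rfl⟩ := hB'
  induction l generalizing l' with
  | nil =>
    cases l' with
    | nil => simp_all
    | cons e l' =>
      simp only [List.nil_append, List.cons_append, List.cons.injEq] at h
      have := hl' e (by simp)
      rw [← h.1] at this
      simp at this
  | cons e l ih =>
    cases l' with
    | nil =>
      simp only [List.nil_append, List.cons_append, List.cons.injEq] at h
      have := hl e (by simp)
      rw [h.1] at this
      simp at this
    | cons e' l' =>
      simp only [List.cons_append, List.cons.injEq] at h
      rw [List.cons_append, List.cons_append, h.1,
        ih (fun e he => hl e (by simp [he])) l' (fun e he => hl' e (by simp [he])) h.2]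

/-- If a batch lies within the first `n` entries of a list, it can be read off these entries. -/
theorem IsBatch.eq_of_take_eq {β : Type*} {B B' X X' : List (β × Bool)} {n : ℕ} (hB : IsBatch B)
    (hB' : IsBatch B') (hn : B.length ≤ n) (h : (B ++ X).take n = (B' ++ X').take n) : B = B' := by
  refine hB.eq_of_append_eq (X := X.take (n - B.length) ++ (B' ++ X').drop n) (X' := X') hB' ?_
  have h1 : (B ++ X).take n = B ++ X.take (n - B.length) := by
    rw [List.take_append, List.take_of_length_le hn]
  rw [← List.append_assoc, ← h1, h, List.take_append_drop]

theorem take_append_diaryStack_eq {α : Type*} {Λ r : ℕ} {B B' : List α} {T T' : List (List α)}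
    (h : diary Λ (B :: T) = diary Λ (B' :: T'))
    (hr : (diaryStack Λ (B :: T)).take r = (diaryStack Λ (B' :: T')).take r) :
    (B ++ diaryStack Λ T).take (Λ + r) = (B' ++ diaryStack Λ T').take (Λ + r) := by
  rw [diary, diary, List.cons.injEq, Subtype.mk.injEq] at h
  rw [diaryStack, diaryStack] at hr
  rw [List.take_add, List.take_add, h.1, hr]

theorem length_flatten_take_succ {α : Type*} {Bs : List (List α)} {n : ℕ} (hn : n < Bs.length) :
    (Bs.take (n + 1)).flatten.length = (Bs.take n).flatten.length + Bs[n].length := by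
  rw [List.take_succ_eq_append_getElem hn, List.flatten_append, List.length_append,
    List.flatten_singleton]

/-- Decoding runs from the newest letter backwards. With `r` top entries of the stack known, the
letter written before that stack was left reveals `Λ + r` entries at the top of the batch and the
older stack. While the batch fits, the flag shows its end and the remaining `Λ + r - |B|` entries
are known of the older stack. -/
theorem take_eq_of_diary_eq {β : Type*} {Λ : ℕ} {Bs Bs' : List (List (β × Bool))}
    (hBs : ∀ B ∈ Bs, IsBatch B) (hBs' : ∀ B ∈ Bs', IsBatch B) (hlen : Bs.length = Bs'.length)
    (h : diary Λ Bs = diary Λ Bs') {n : ℕ} (hn : n ≤ Bs.length)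
    (hsum : ∀ m ≤ n, (Bs.take m).flatten.length ≤ Λ * m) :
    Bs.take n = Bs'.take n ∧
      (diaryStack Λ (Bs.drop n)).take (Λ * n - (Bs.take n).flatten.length) =
        (diaryStack Λ (Bs'.drop n)).take (Λ * n - (Bs.take n).flatten.length) := by
  induction n with
  | zero => simp
  | succ n ih =>
    obtain ⟨ih1, ih2⟩ := ih (by omega) fun m hm => hsum m (by omega)
    have hd : Bs.drop n = Bs[n] :: Bs.drop (n + 1) := List.drop_eq_getElem_cons (by omega)
    have hd' : Bs'.drop n = Bs'[n] :: Bs'.drop (n + 1) := List.drop_eq_getElem_cons (by omega)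
    have hl := congrArg (List.drop n) h
    rw [drop_diary, drop_diary, hd, hd'] at hl
    rw [hd, hd'] at ih2
    have htake := take_append_diaryStack_eq hl ih2
    have hs1 := hsum n (by omega)
    have hs2 := hsum (n + 1) le_rfl
    have ht := length_flatten_take_succ (show n < Bs.length by omega)
    set r := Λ * n - (Bs.take n).flatten.length with hr
    have hr' : Λ * (n + 1) - (Bs.take (n + 1)).flatten.length = Λ + r - Bs[n].length := by
      rw [ht, hr, Nat.mul_succ]; omega
    have hbound : Bs[n].length ≤ Λ + r := by
      rw [ht, Nat.mul_succ] at hs2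
      omega
    have hB : Bs[n] = Bs'[n] := (hBs _ (List.getElem_mem _)).eq_of_take_eq
      (hBs' _ (List.getElem_mem _)) hbound htake
    constructor
    · rw [List.take_succ_eq_append_getElem (by omega), List.take_succ_eq_append_getElem (by omega),
        ih1, hB]
    · rw [hr']
      rw [List.take_append, List.take_append, hB] at htake
      rw [hB]
      exact List.append_cancel_left htake

/-- If two diaries agree, their histories agree as far back as the budget of the diary allows. -/
theorem take_flatten_eq_of_diary_eq {β : Type*} {Λ : ℕ} {P P' S : List (List (β × Bool))}
    (hBs : ∀ B ∈ P ++ S, IsBatch B) (hBs' : ∀ B ∈ P' ++ S, IsBatch B)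
    (hlen : P.length = P'.length) (h : diary Λ (P ++ S) = diary Λ (P' ++ S)) {n : ℕ}
    (hn : n ≤ P.length) (hsum : ∀ m ≤ n, ((P ++ S).take m).flatten.length ≤ Λ * m) :
    (P ++ S).flatten.take (Λ * n) = (P' ++ S).flatten.take (Λ * n) := by
  have hlen' : (P ++ S).length = (P' ++ S).length := by simp [hlen]
  induction hn using Nat.decreasingInduction with
  | self =>
    have := (take_eq_of_diary_eq hBs hBs' hlen' h (by simp) hsum).1
    rw [List.take_left, hlen, List.take_left] at this
    rw [this]
  | of_succ n hn ih =>
    -- If the budget fails at `n + 1`, the batch number `n` is longer than the visible `Λ + r`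
    -- entries, in both histories. The `Λ * n` newest entries then end within the visible part of
    -- this batch.
    by_cases hs : ((P ++ S).take (n + 1)).flatten.length ≤ Λ * (n + 1)
    · have := ih fun m hm => by
        rcases Nat.le_succ_iff.1 hm with hm | rfl
        · exact hsum m hm
        · exact hs
      have h2 := congrArg (List.take (Λ * n)) this
      rwa [List.take_take, List.take_take, min_eq_left (Nat.mul_le_mul_left _ (by omega))] at h2
    · have hnl : n < (P ++ S).length := by rw [List.length_append]; omega
      have hnl' : n < (P' ++ S).length := hlen' ▸ hnl
      obtain ⟨h1, h2⟩ := take_eq_of_diary_eq hBs hBs' hlen' h hnl.le hsum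
      have hs1 := hsum n le_rfl
      have hd := List.drop_eq_getElem_cons hnl
      have hd' := List.drop_eq_getElem_cons hnl'
      have hl := congrArg (List.drop n) h
      rw [drop_diary, drop_diary, hd, hd'] at hl
      rw [hd, hd'] at h2
      have htake := take_append_diaryStack_eq hl h2
      rw [length_flatten_take_succ hnl, Nat.mul_succ] at hs
      have hshort : Λ + (Λ * n - ((P ++ S).take n).flatten.length) ≤ (P ++ S)[n].length := by omega
      have hshort' : Λ + (Λ * n - ((P ++ S).take n).flatten.length) ≤ (P' ++ S)[n].length := by
        by_contra! hlt
        have := (hBs' _ (List.getElem_mem hnl')).eq_of_take_eq (hBs _ (List.getElem_mem hnl))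
          hlt.le htake.symm
        rw [this] at hlt
        omega
      rw [List.take_append_of_le_length hshort, List.take_append_of_le_length hshort'] at htake
      have hflat : ∀ Q : List (List (β × Bool)), Q.flatten =
          (Q.take n).flatten ++ (Q.drop n).flatten := fun Q => by
        rw [← List.flatten_append, List.take_append_drop]
      have hle : Λ * n - ((P ++ S).take n).flatten.length ≤
          Λ + (Λ * n - ((P ++ S).take n).flatten.length) := by omega
      have h3 := congrArg (List.take (Λ * n - ((P ++ S).take n).flatten.length)) htake
      rw [List.take_take, List.take_take, min_eq_left hle] at h3
      rw [hflat (P ++ S), hflat (P' ++ S), ← h1,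
        List.take_append (l₁ := ((P ++ S).take n).flatten),
        List.take_append (l₁ := ((P ++ S).take n).flatten), hd, hd',
        List.flatten_cons, List.flatten_cons, List.take_append_of_le_length (hle.trans hshort),
        List.take_append_of_le_length (hle.trans hshort'), h3]

/-! ### The ruler sequence -/

/-- The parity of the exponent of `2` in `l`. -/
def ruler (l : ℕ) : Bool := (padicValNat 2 l).bodd

theorem padicValNat_two_pow_mul_odd (e x : ℕ) (hx : x % 2 = 1) :
    padicValNat 2 (2 ^ e * x) = e := by
  have hx0 : x ≠ 0 := by rintro rfl; simp at hx
  rw [padicValNat.mul (by positivity) hx0, padicValNat.prime_pow,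
    padicValNat.eq_zero_of_not_dvd (by omega), add_zero]

/-- A misalignment of two histories by `q` levels is thus noticed within `4 * q` consecutive
entries. -/
theorem exists_ruler_ne (a : ℕ) {q : ℕ} (hq : 0 < q) :
    ∃ t < 4 * q, ruler (a + t) ≠ ruler (a + t + q) := by
  obtain ⟨e, u, hu, rfl⟩ := Nat.exists_eq_two_pow_mul_odd hq.ne'
  have hu' := Nat.odd_iff.1 hu
  -- a multiple `2 ^ e * x` with `x + u ≡ 2` modulo `4`
  obtain ⟨x, hax, hxa, hx⟩ : ∃ x, a ≤ 2 ^ e * x ∧ 2 ^ e * x < a + 2 ^ e * 4 ∧ (x + u) % 4 = 2 := by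
    have hpos : 0 < 2 ^ e := by positivity
    set y := (a + 2 ^ e - 1) / 2 ^ e with hy
    have h1 : a ≤ 2 ^ e * y := by
      have := Nat.lt_mul_div_succ (a + 2 ^ e - 1) hpos
      rw [← hy, Nat.mul_add] at this
      omega
    have h2 : 2 ^ e * y < a + 2 ^ e := by
      have := Nat.mul_div_le (a + 2 ^ e - 1) (2 ^ e)
      rw [← hy] at this
      omega
    obtain ⟨d, hd, hdx⟩ : ∃ d < 4, (y + d + u) % 4 = 2 :=
      ⟨(6 - (y + u) % 4) % 4, by omega, by omega⟩
    refine ⟨y + d, ?_, ?_, hdx⟩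
    · exact h1.trans (Nat.mul_le_mul_left _ (by omega))
    · have : 2 ^ e * (y + d) ≤ 2 ^ e * y + 2 ^ e * 3 := by
        rw [← Nat.mul_add]
        exact Nat.mul_le_mul_left _ (by omega)
      omega
  refine ⟨2 ^ e * x - a, ?_, ?_⟩
  · have : 2 ^ e * 1 ≤ 2 ^ e * u := Nat.mul_le_mul_left _ (by omega)
    omega
  · rw [Nat.add_sub_cancel' hax]
    have h1 : 2 ^ e * x + 2 ^ e * u = 2 ^ (e + 1) * ((x + u) / 2) := by
      rw [pow_succ, mul_assoc, Nat.mul_div_cancel' (by omega), Nat.mul_add]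
    rw [h1, ruler, ruler, padicValNat_two_pow_mul_odd _ _ (by omega),
      padicValNat_two_pow_mul_odd _ _ (by omega), Nat.bodd_succ]
    cases e.bodd <;> simp

/-! ### Diaries of lists of rooms -/

section Rooms

variable {ρ β : Type*}

/-- The level of the newest room. -/
def topLevel (lv : ρ → ℕ) : List ρ → ℕ
  | [] => 0
  | U :: _ => lv U

/-- The levels of the rooms, newest first, are positive and decrease strictly. -/
def LevelSorted (lv : ρ → ℕ) : List ρ → Prop
  | [] => True
  | U :: T => topLevel lv T < lv U ∧ LevelSorted lv T

/-- The history of a list of rooms: the room `U` entered after the rooms in `T` contributes the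
entries of the levels from its own down to the one above the level of the preceding room. -/
def batches (lv : ρ → ℕ) (e : ρ → ℕ → β) : List ρ → List (List (β × Bool))
  | [] => []
  | U :: T => ((List.range (lv U - topLevel lv T)).map fun t =>
      (e U (lv U - t), decide (t + 1 = lv U - topLevel lv T))) :: batches lv e T

variable {lv : ρ → ℕ} {e : ρ → ℕ → β}

theorem length_batches (R : List ρ) : (batches lv e R).length = R.length := by
  induction R with
  | nil => rfl
  | cons U T ih => simp [batches, ih]

theorem drop_batches (R : List ρ) (n : ℕ) :
    (batches lv e R).drop n = batches lv e (R.drop n) := by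
  induction R generalizing n with
  | nil => simp [batches]
  | cons U T ih =>
    cases n with
    | zero => rfl
    | succ n => simpa [batches] using ih n

theorem LevelSorted.drop {R : List ρ} (h : LevelSorted lv R) (n : ℕ) :
    LevelSorted lv (R.drop n) := by
  induction R generalizing n with
  | nil => simpa using h
  | cons U T ih =>
    cases n with
    | zero => exact h
    | succ n => exact ih h.2 n

theorem LevelSorted.topLevel_drop_add_le {R : List ρ} (h : LevelSorted lv R) {n : ℕ}
    (hn : n ≤ R.length) : topLevel lv (R.drop n) + n ≤ topLevel lv R := by
  induction R generalizing n with
  | nil => simp at hn; simp [hn]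
  | cons U T ih =>
    cases n with
    | zero => simp
    | succ n =>
      have := ih h.2 (n := n) (by simpa using hn)
      have h1 := h.1
      rw [List.drop_succ_cons]
      have h2 : topLevel lv (U :: T) = lv U := rfl
      omega

theorem LevelSorted.isBatch {R : List ρ} (h : LevelSorted lv R) :
    ∀ B ∈ batches lv e R, IsBatch B := by
  induction R with
  | nil => simp [batches]
  | cons U T ih =>
    intro B hB
    rw [batches, List.mem_cons] at hB
    rcases hB with rfl | hB
    · obtain ⟨m, hm⟩ : ∃ m, lv U - topLevel lv T = m + 1 :=
        ⟨lv U - topLevel lv T - 1, by have := h.1; omega⟩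
      refine ⟨(List.range m).map fun t => (e U (lv U - t), false), e U (lv U - m), by simp, ?_⟩
      rw [hm, List.range_succ, List.map_append]
      congr 1
      · refine List.map_congr_left fun t ht => ?_
        rw [List.mem_range] at ht
        simp only [Prod.mk.injEq, true_and, decide_eq_false_iff_not]
        omega
      · simp
    · exact ih h.2 B hB

theorem LevelSorted.length_flatten_batches {R : List ρ} (h : LevelSorted lv R) :
    (batches lv e R).flatten.length = topLevel lv R := by
  induction R with
  | nil => rfl
  | cons U T ih =>
    rw [batches, List.flatten_cons, List.length_append, ih h.2, List.length_map, List.length_range,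
      topLevel]
    have := h.1
    omega

/-- The batches tile the levels from the top down to `1` without gaps, so the position `t` in the
history belongs to the level `topLevel lv R - t`. -/
theorem LevelSorted.getElem_flatten_batches {R : List ρ} (h : LevelSorted lv R) {t : ℕ}
    (ht : t < topLevel lv R) : ∃ U ∈ R, topLevel lv R - t ≤ lv U ∧
      ∃ b, (batches lv e R).flatten[t]? = some (e U (topLevel lv R - t), b) := by
  induction R generalizing t with
  | nil => simp [topLevel] at ht
  | cons U T ih =>
    have h1 := h.1
    rw [topLevel] at ht ⊢
    by_cases hlt : t < lv U - topLevel lv T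
    · refine ⟨U, by simp, by omega, decide (t + 1 = lv U - topLevel lv T), ?_⟩
      rw [batches, List.flatten_cons, List.getElem?_append_left (by simpa using hlt)]
      simp [hlt]
    · obtain ⟨W, hW, hle, b, hb⟩ := ih h.2 (t := t - (lv U - topLevel lv T)) (by omega)
      have heq : topLevel lv T - (t - (lv U - topLevel lv T)) = lv U - t := by omega
      rw [heq] at hle hb
      refine ⟨W, by simp [hW], hle, b, ?_⟩
      rw [batches, List.flatten_cons, List.getElem?_append_right (by simpa using hlt)]
      simpa using hb

/-- If two lists of rooms with the same diary have a common beginning `S` and the later rooms,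
except the first two, have levels in `(N, N + K]`, then they have equal entries on the levels
slightly above `N`. -/
theorem exists_entry_eq_of_diary_eq {f : ρ → ℕ → β} {Λ N K C₀ : ℕ} {R R' P P' S : List ρ}
    (hR : LevelSorted lv R) (hR' : LevelSorted lv R') (hP : R = P ++ S) (hP' : R' = P' ++ S)
    (hlen : R.length = R'.length)
    (hN : ∀ n, S.length + 2 < (R.drop n).length → N < topLevel lv (R.drop n))
    (hN' : ∀ n, S.length + 2 < (R'.drop n).length → N < topLevel lv (R'.drop n))
    (hK : topLevel lv R ≤ N + K) (hK' : topLevel lv R' ≤ N + K)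
    (hword : diary Λ (batches lv (fun U l => (f U l, ruler l)) R) =
      diary Λ (batches lv (fun U l => (f U l, ruler l)) R'))
    (hS : S.length + 3 ≤ R.length) (hbudget : 6 * K ≤ Λ * (R.length - S.length - 3))
    (hΛ : 0 < Λ) (hC₀ : Λ * C₀ ≤ 5 * K) {l : ℕ} (hl : N < l) (hl' : l ≤ N + C₀) :
    ∃ U ∈ R, ∃ U' ∈ R', l ≤ lv U ∧ l ≤ lv U' ∧ f U l = f U' l := by
  set D := R.length - S.length - 3 with hD
  -- The newest rooms may come with a debt that is never read off. Dropping `n` of them, with `n`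
  -- minimizing level plus `Λ * n`, leaves a list in which any `m ≤ n₀` newest batches have at most
  -- `Λ * m` entries, as the decoding requires.
  obtain ⟨n, hn, hmin⟩ := Finset.exists_min_image (Finset.range (D + 1))
    (fun n => topLevel lv (R.drop n) + Λ * n) ⟨0, by simp⟩
  rw [Finset.mem_range] at hn
  have hmin0 := hmin 0 (by simp)
  simp only [List.drop_zero, Nat.mul_zero, Nat.add_zero] at hmin0
  set R₁ := R.drop n with hR₁
  set R₁' := R'.drop n with hR₁'
  set n₀ := D - n with hn₀
  have hlR₁ : R₁.length = R.length - n := List.length_drop ..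
  have hlR₁' : R₁'.length = R.length - n := by rw [hR₁', List.length_drop, hlen]
  have hlev : N < topLevel lv R₁ := hN n (by rw [List.length_drop]; omega)
  have hlev' : N < topLevel lv R₁' := hN' n (by rw [List.length_drop]; omega)
  have hsort : LevelSorted lv R₁ := hR.drop n
  have hsort' : LevelSorted lv R₁' := hR'.drop n
  have hgrow : N + n₀ < topLevel lv R₁ := by
    have h1 := hsort.topLevel_drop_add_le (n := n₀) (by omega)
    have h2 := hN (n + n₀) (by rw [List.length_drop]; omega)
    rw [← List.drop_drop, ← hR₁] at h2
    omega
  have hle : topLevel lv R₁ ≤ N + K := by omega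
  have hle' : topLevel lv R₁' ≤ N + K := by
    have := hR'.topLevel_drop_add_le (n := n) (by omega)
    rw [← hR₁'] at this
    omega
  -- The `Λ * n₀` decoded entries outnumber by `5 * K` the levels from the top down to just above
  -- `N`.
  have hW : 5 * K + topLevel lv R₁ ≤ Λ * n₀ + N := by
    have : Λ * D = Λ * n + Λ * n₀ := by rw [← Nat.mul_add]; congr 1; omega
    omega
  have hC₀n : C₀ ≤ n₀ := by
    have : Λ * C₀ ≤ Λ * n₀ := by omega
    exact Nat.le_of_mul_le_mul_left this hΛ
  -- the histories agree on the `Λ * n₀` newest entries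
  set E : ρ → ℕ → β × Bool := fun U l => (f U l, ruler l) with hE
  have hPl : R.length = P.length + S.length := by rw [hP, List.length_append]
  have hPl' : R'.length = P'.length + S.length := by rw [hP', List.length_append]
  have hsplit : ∀ {T P : List ρ}, T = P ++ S → n ≤ P.length →
      batches lv E (T.drop n) =
        (batches lv E (T.drop n)).take (P.length - n) ++ batches lv E S := by
    intro T P hT hnP
    conv_lhs => rw [← List.take_append_drop (P.length - n) (batches lv E (T.drop n))]
    rw [drop_batches, List.drop_drop, Nat.add_sub_cancel' hnP, hT, List.drop_left]
  have hb : batches lv E R₁ = (batches lv E R₁).take (P.length - n) ++ batches lv E S :=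
    hsplit hP (by omega)
  have hb' : batches lv E R₁' = (batches lv E R₁').take (P'.length - n) ++ batches lv E S :=
    hsplit hP' (by omega)
  have hword₁ : diary Λ (batches lv E R₁) = diary Λ (batches lv E R₁') := by
    have := congrArg (List.drop n) hword
    rwa [drop_diary, drop_diary, drop_batches, drop_batches] at this
  have htake : (batches lv E R₁).flatten.take (Λ * n₀) =
      (batches lv E R₁').flatten.take (Λ * n₀) := by
    rw [hb, hb']
    refine take_flatten_eq_of_diary_eq ?_ ?_ ?_ ?_ ?_ ?_
    · rw [← hb]; exact hsort.isBatch
    · rw [← hb']; exact hsort'.isBatch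
    · simp only [List.length_take, length_batches, hlR₁, hlR₁']
      omega
    · rw [← hb, ← hb', hword₁]
    · simp only [List.length_take, length_batches, hlR₁]
      omega
    · intro m hm
      rw [← hb]
      have h1 := hsort.length_flatten_batches (e := E)
      rw [← List.take_append_drop m (batches lv E R₁), List.flatten_append, List.length_append,
        drop_batches, (hsort.drop m).length_flatten_batches] at h1
      have h2 := hmin (n + m) (by rw [Finset.mem_range]; omega)
      rw [Nat.mul_add, ← List.drop_drop, ← hR₁] at h2
      omega
  have hentry : ∀ t < Λ * n₀, t < topLevel lv R₁ → t < topLevel lv R₁' →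
      ∃ U ∈ R, ∃ U' ∈ R', topLevel lv R₁ - t ≤ lv U ∧ topLevel lv R₁' - t ≤ lv U' ∧
        E U (topLevel lv R₁ - t) = E U' (topLevel lv R₁' - t) := by
    intro t ht h1 h2
    obtain ⟨U, hU, hUl, b, hb⟩ := hsort.getElem_flatten_batches (e := E) h1
    obtain ⟨U', hU', hUl', b', hb'⟩ := hsort'.getElem_flatten_batches (e := E) h2
    refine ⟨U, List.mem_of_mem_drop hU, U', List.mem_of_mem_drop hU', hUl, hUl', ?_⟩
    have h3 := congrArg (fun L => L[t]?) htake
    simp only [List.getElem?_take_of_lt ht, hb, hb', Option.some.injEq, Prod.mk.injEq] at h3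
    exact h3.1
  have hruler : ∀ a b q : ℕ, 0 < q → b = a + q → 4 * q ≤ a →
      ∃ t < 4 * q, ruler (a - t) ≠ ruler (b - t) := by
    rintro a b q hq rfl hqa
    obtain ⟨t, ht, hne⟩ := exists_ruler_ne (a - 4 * q + 1) hq
    refine ⟨4 * q - 1 - t, by omega, ?_⟩
    have h1 : a - (4 * q - 1 - t) = a - 4 * q + 1 + t := by omega
    have h2 : a + q - (4 * q - 1 - t) = a - 4 * q + 1 + t + q := by omega
    rwa [h1, h2]
  -- If the top levels differed, by some `q ≤ K`, equal length of the decoded parts would force both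
  -- histories to have at least `Λ * n₀ ≥ 5 * K` entries. That exceeds the window `4 * q` in which
  -- the ruler bits must disagree.
  have heq : topLevel lv R₁ = topLevel lv R₁' := by
    have hl := congrArg List.length htake
    rw [List.length_take, List.length_take, hsort.length_flatten_batches,
      hsort'.length_flatten_batches] at hl
    by_contra hne
    rcases lt_or_gt_of_ne hne with hlt | hgt
    · obtain ⟨t, ht, hne⟩ := hruler (topLevel lv R₁) (topLevel lv R₁')
        (topLevel lv R₁' - topLevel lv R₁) (by omega) (by omega) (by omega)
      obtain ⟨U, -, U', -, -, -, h⟩ := hentry t (by omega) (by omega) (by omega)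
      exact hne (Prod.mk.inj h).2
    · obtain ⟨t, ht, hne⟩ := hruler (topLevel lv R₁') (topLevel lv R₁)
        (topLevel lv R₁ - topLevel lv R₁') (by omega) (by omega) (by omega)
      obtain ⟨U, -, U', -, -, -, h⟩ := hentry t (by omega) (by omega) (by omega)
      exact hne (Prod.mk.inj h).2.symm
  obtain ⟨U, hU, U', hU', h1, h2, h3⟩ := hentry (topLevel lv R₁ - l) (by omega) (by omega)
    (by omega)
  have hl1 : topLevel lv R₁ - (topLevel lv R₁ - l) = l := by omega
  rw [← heq, hl1] at h2 h3
  rw [hl1] at h1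
  exact ⟨U, hU, U', hU', h1, h2, (Prod.mk.inj h3).1⟩

end Rooms

/-! ### The rooms around a point -/

open Classical in
/-- The rooms of the levels `1, …, j` that contain the set `B`, newest first. -/
noncomputable def roomList {Z : Type*} (𝒱 : ℕ → Set (Set Z)) (B : Set Z) :
    ℕ → List (ℕ × Set Z)
  | 0 => []
  | j + 1 => if h : ∃ V, V ∈ 𝒱 (j + 1) ∧ B ⊆ V then (j + 1, h.choose) :: roomList 𝒱 B j
      else roomList 𝒱 B j

section RoomList

variable {Z : Type*} {𝒱 : ℕ → Set (Set Z)} {B B' : Set Z}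

theorem roomList_succ_of_exists {j : ℕ} (h : ∃ V, V ∈ 𝒱 (j + 1) ∧ B ⊆ V) :
    ∃ V, V ∈ 𝒱 (j + 1) ∧ B ⊆ V ∧ roomList 𝒱 B (j + 1) = (j + 1, V) :: roomList 𝒱 B j :=
  ⟨h.choose, h.choose_spec.1, h.choose_spec.2, by rw [roomList, dif_pos h]⟩

theorem roomList_succ_of_not_exists {j : ℕ} (h : ¬ ∃ V, V ∈ 𝒱 (j + 1) ∧ B ⊆ V) :
    roomList 𝒱 B (j + 1) = roomList 𝒱 B j := by
  rw [roomList, dif_neg h]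

theorem drop_roomList {j m : ℕ} {U : ℕ × Set Z} {T : List (ℕ × Set Z)}
    (h : (roomList 𝒱 B j).drop m = U :: T) :
    1 ≤ U.1 ∧ U.1 ≤ j ∧ U.2 ∈ 𝒱 U.1 ∧ B ⊆ U.2 ∧ U :: T = roomList 𝒱 B U.1 := by
  induction j generalizing m with
  | zero => simp [roomList] at h
  | succ j ih =>
    by_cases hex : ∃ V, V ∈ 𝒱 (j + 1) ∧ B ⊆ V
    · obtain ⟨V, hV, hBV, heq⟩ := roomList_succ_of_exists hex
      rw [heq] at h
      cases m with
      | zero =>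
        rw [List.drop_zero, List.cons.injEq] at h
        obtain ⟨rfl, rfl⟩ := h
        exact ⟨by simp, le_rfl, hV, hBV, heq.symm⟩
      | succ m =>
        obtain ⟨h1, h2, h3⟩ := ih h
        exact ⟨h1, by omega, h3⟩
    · rw [roomList_succ_of_not_exists hex] at h
      obtain ⟨h1, h2, h3⟩ := ih h
      exact ⟨h1, by omega, h3⟩

theorem mem_roomList {j : ℕ} {U : ℕ × Set Z} (h : U ∈ roomList 𝒱 B j) :
    1 ≤ U.1 ∧ U.1 ≤ j ∧ U.2 ∈ 𝒱 U.1 ∧ B ⊆ U.2 := by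
  obtain ⟨m, hm, rfl⟩ := List.mem_iff_getElem.1 h
  obtain ⟨h1, h2, h3, h4, -⟩ := drop_roomList (List.drop_eq_getElem_cons hm)
  exact ⟨h1, h2, h3, h4⟩

theorem topLevel_drop_roomList_le (j m : ℕ) :
    topLevel Prod.fst ((roomList 𝒱 B j).drop m) ≤ j := by
  cases h : (roomList 𝒱 B j).drop m with
  | nil => exact Nat.zero_le _
  | cons U T => exact (drop_roomList h).2.1

theorem levelSorted_roomList (j : ℕ) : LevelSorted Prod.fst (roomList 𝒱 B j) := by
  induction j with
  | zero => trivial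
  | succ j ih =>
    by_cases hex : ∃ V, V ∈ 𝒱 (j + 1) ∧ B ⊆ V
    · obtain ⟨V, -, -, heq⟩ := roomList_succ_of_exists hex
      rw [heq]
      exact ⟨Nat.lt_succ_of_le (topLevel_drop_roomList_le j 0), ih⟩
    · rwa [roomList_succ_of_not_exists hex]

theorem roomList_suffix {i j : ℕ} (hij : i ≤ j) : roomList 𝒱 B i <:+ roomList 𝒱 B j := by
  induction hij with
  | refl => exact List.suffix_refl _
  | @step j _ ih =>
    by_cases hex : ∃ V, V ∈ 𝒱 (j + 1) ∧ B ⊆ V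
    · obtain ⟨V, -, -, heq⟩ := roomList_succ_of_exists hex
      rw [heq]
      exact ih.trans (List.suffix_cons _ _)
    · rwa [roomList_succ_of_not_exists hex]

theorem length_roomList_le {i j : ℕ} (hij : i ≤ j) :
    (roomList 𝒱 B j).length ≤ (roomList 𝒱 B i).length + (j - i) := by
  induction hij with
  | refl => simp
  | @step j hij ih =>
    by_cases hex : ∃ V, V ∈ 𝒱 (j + 1) ∧ B ⊆ V
    · obtain ⟨V, -, -, heq⟩ := roomList_succ_of_exists hex
      rw [heq, List.length_cons]
      have : i ≤ j := hij
      omega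
    · rw [roomList_succ_of_not_exists hex]
      omega

theorem lt_topLevel_drop_roomList {i j m : ℕ}
    (h : (roomList 𝒱 B i).length < ((roomList 𝒱 B j).drop m).length) :
    i < topLevel Prod.fst ((roomList 𝒱 B j).drop m) := by
  cases hd : (roomList 𝒱 B j).drop m with
  | nil => simp [hd] at h
  | cons U T =>
    by_contra! hle
    have h1 := (roomList_suffix (𝒱 := 𝒱) (B := B) (show U.1 ≤ i from hle)).length_le
    rw [← (drop_roomList hd).2.2.2.2, ← hd] at h1
    omega

/-- Each level contributes a room of some color. -/
theorem le_sum_length_roomList {n : ℕ} {𝒱 : Fin n → ℕ → Set (Set Z)} {N k : ℕ} (hN : N ≤ k)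
    (h : ∀ j, 1 ≤ j → j ≤ k → ∃ c, ∃ V, V ∈ 𝒱 c j ∧ B ⊆ V) :
    k - N ≤ ∑ c, ((roomList (𝒱 c) B k).length - (roomList (𝒱 c) B N).length) := by
  have key : ∑ c, (roomList (𝒱 c) B N).length + (k - N) ≤ ∑ c, (roomList (𝒱 c) B k).length := by
    induction hN with
    | refl => simp
    | @step k hN ih =>
      have ih := ih fun j h1 h2 => h j h1 (by omega)
      have : ∑ c, (roomList (𝒱 c) B k).length < ∑ c, (roomList (𝒱 c) B (k + 1)).length := by
        obtain ⟨c, hc⟩ := h (k + 1) (by omega) le_rfl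
        refine Finset.sum_lt_sum (fun c _ => (roomList_suffix (Nat.le_succ k)).length_le)
          ⟨c, Finset.mem_univ _, ?_⟩
        obtain ⟨V, -, -, heq⟩ := roomList_succ_of_exists hc
        rw [heq]
        simp
      have hN' : N ≤ k := hN
      rw [Nat.succ_eq_add_one, Nat.sub_add_comm hN']
      omega
  have hsplit : ∑ c, (roomList (𝒱 c) B k).length =
      ∑ c, ((roomList (𝒱 c) B k).length - (roomList (𝒱 c) B N).length) +
        ∑ c, (roomList (𝒱 c) B N).length := by
    rw [← Finset.sum_add_distrib]
    exact Finset.sum_congr rfl fun c _ =>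
      (Nat.sub_add_cancel (roomList_suffix hN).length_le).symm
  omega

variable [MetricSpace Z] {s : ℝ} {σ : ℕ → ℝ}

theorem IsLaminar.subset (h : IsLaminar 𝒱 s σ) (hs : ∀ i, 0 < s * σ i) {i j : ℕ} (hij : i < j)
    {V W : Set Z} (hV : V ∈ 𝒱 i) (hW : W ∈ 𝒱 j) {x : Z} (hxV : x ∈ V) (hxW : x ∈ W) : W ⊆ V :=
  fun y hy => h.mem_of_near i j hij V hV W hW x hxV hxW y hy y (by rw [dist_self]; exact hs j)

/-- A room of level at most `i` that contains one of the sets meets `V`, hence contains `V` and the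
other set. -/
theorem IsLaminar.roomList_eq (h : IsLaminar 𝒱 s σ) (hs : ∀ i, 0 < s * σ i) (hB : B.Nonempty)
    (hB' : B'.Nonempty) {i : ℕ} {V : Set Z} (hV : V ∈ 𝒱 i) (hBV : B ⊆ V) (hBV' : B' ⊆ V) :
    roomList 𝒱 B i = roomList 𝒱 B' i := by
  have key : ∀ {B B' : Set Z}, B.Nonempty → B ⊆ V → B' ⊆ V → ∀ m ≤ i, ∀ W ∈ 𝒱 m, B ⊆ W →
      B' ⊆ W := by
    rintro B B' ⟨x, hx⟩ hBV hBV' m hm W hW hBW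
    rcases hm.lt_or_eq with hlt | rfl
    · exact hBV'.trans (h.subset hs hlt hW hV (hBW hx) (hBV hx))
    · rwa [h.eq_of_mem m W hW V hV x (hBW hx) (hBV hx)]
  suffices ∀ m ≤ i, roomList 𝒱 B m = roomList 𝒱 B' m from this i le_rfl
  intro m
  induction m with
  | zero => exact fun _ => rfl
  | succ m ih =>
    intro hm
    by_cases hex : ∃ W, W ∈ 𝒱 (m + 1) ∧ B ⊆ W
    · obtain ⟨W, hW, hBW, heq⟩ := roomList_succ_of_exists hex
      have hBW' := key hB hBV hBV' _ hm W hW hBW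
      obtain ⟨W', hW', hBW'', heq'⟩ := roomList_succ_of_exists ⟨W, hW, hBW'⟩
      obtain ⟨x, hx⟩ := hB'
      rw [heq, heq', ih (by omega), h.eq_of_mem _ W hW W' hW' x (hBW' hx) (hBW'' hx)]
    · have hex' : ¬ ∃ W, W ∈ 𝒱 (m + 1) ∧ B' ⊆ W := fun ⟨W, hW, hBW⟩ =>
        hex ⟨W, hW, key hB' hBV' hBV _ hm W hW hBW⟩
      rw [roomList_succ_of_not_exists hex, roomList_succ_of_not_exists hex', ih (by omega)]

/-- The rooms around two points whose distance is less than `s σ N` agree up to level `N`, except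
for the last two. -/
theorem IsLaminar.drop_two_roomList_suffix (h : IsLaminar 𝒱 s σ) (hs : ∀ i, 0 < s * σ i)
    (hanti : ∀ i j, i ≤ j → s * σ j ≤ s * σ i) {z z' : Z} {k k' N : ℕ} (hk' : N ≤ k')
    (hd : dist z z' < s * σ N) :
    (roomList 𝒱 (Metric.ball z (s * σ k)) N).drop 2 <:+
      roomList 𝒱 (Metric.ball z' (s * σ k')) N := by
  set B := Metric.ball z (s * σ k) with hB
  have hzB : z ∈ B := Metric.mem_ball_self (hs k)
  have hzB' : z' ∈ Metric.ball z' (s * σ k') := Metric.mem_ball_self (hs k')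
  have hsort := levelSorted_roomList (𝒱 := 𝒱) (B := B) N
  match hR : roomList 𝒱 B N with
  | [] => simp
  | [_] => simp
  | [_, _] => simp
  | Uc :: Ub :: Ua :: T =>
    rw [hR] at hsort
    have hcb : Ub.1 < Uc.1 := hsort.1
    have hba : Ua.1 < Ub.1 := hsort.2.1
    obtain ⟨-, hcN, hcV, hcB, -⟩ := drop_roomList (m := 0) hR
    obtain ⟨-, -, hbV, hbB, -⟩ := drop_roomList (𝒱 := 𝒱) (B := B) (j := N) (m := 1) (U := Ub)
      (T := Ua :: T) (by rw [hR]; rfl)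
    obtain ⟨-, haN, haV, haB, haT⟩ := drop_roomList (𝒱 := 𝒱) (B := B) (j := N) (m := 2) (U := Ua)
      (T := T) (by rw [hR]; rfl)
    -- Two rooms are lost for two reasons: the room `Ub` has enough margin around `Uc` to contain
    -- `z'`, and `Ua` has enough margin around `Ub` to contain the whole ball around `z'`.
    have hz'b : z' ∈ Ub.2 := h.mem_of_near _ _ hcb _ hbV _ hcV z (hbB hzB) (hcB hzB) z (hcB hzB) z'
      (hd.trans_le (hanti _ _ hcN))
    have hsub : Metric.ball z' (s * σ k') ⊆ Ua.2 := fun w hw => by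
      refine h.mem_of_near _ _ hba _ haV _ hbV z (haB hzB) (hbB hzB) z' hz'b w ?_
      rw [dist_comm]
      exact (Metric.mem_ball.1 hw).trans_le (hanti _ _ (by omega))
    have : (Uc :: Ub :: Ua :: T).drop 2 = roomList 𝒱 B Ua.1 := haT
    rw [this, h.roomList_eq hs ⟨z, hzB⟩ ⟨z', hzB'⟩ haV haB hsub]
    exact roomList_suffix haN

theorem IsLaminar.exists_common_suffix (h : IsLaminar 𝒱 s σ) (hs : ∀ i, 0 < s * σ i)
    (hanti : ∀ i j, i ≤ j → s * σ j ≤ s * σ i) {z z' : Z} {k k' N : ℕ} (hk : N ≤ k)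
    (hk' : N ≤ k') (hd : N = 0 ∨ dist z z' < s * σ N) :
    ∃ S, S <:+ roomList 𝒱 (Metric.ball z (s * σ k)) N ∧
      S <:+ roomList 𝒱 (Metric.ball z' (s * σ k')) N ∧
      (roomList 𝒱 (Metric.ball z (s * σ k)) N).length ≤ S.length + 2 ∧
      (roomList 𝒱 (Metric.ball z' (s * σ k')) N).length ≤ S.length + 2 := by
  rcases hd with rfl | hd
  · exact ⟨[], List.nil_suffix, List.nil_suffix, by simp [roomList], by simp [roomList]⟩
  have h1 := h.drop_two_roomList_suffix (k := k) hs hanti hk' hd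
  have h2 := h.drop_two_roomList_suffix (k := k') hs hanti hk (by rwa [dist_comm])
  rcases le_total (roomList 𝒱 (Metric.ball z (s * σ k)) N).length
    (roomList 𝒱 (Metric.ball z' (s * σ k')) N).length with hle | hle
  · exact ⟨_, h2, List.drop_suffix _ _, by rw [List.length_drop]; omega,
      by rw [List.length_drop]; omega⟩
  · exact ⟨_, List.drop_suffix _ _, h1, by rw [List.length_drop]; omega,
      by rw [List.length_drop]; omega⟩

end RoomList

/-! ### Embedding of the hyperbolic cone -/

/-- The diary of the rooms up to level `k` around the set `B`, with the entries given by the local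
colorings `col l` of the space. -/
noncomputable def roomDiary {Z β : Type*} (𝒱 : ℕ → Set (Set Z)) (col : ℕ → Z → β) (base : Set Z → Z)
    (Λ : ℕ) (B : Set Z) (k : ℕ) : List {l : List ((β × Bool) × Bool) // l.length ≤ Λ} :=
  diary Λ (batches Prod.fst (fun U l => (col l (base U.2), ruler l)) (roomList 𝒱 B k))

section RoomDiary

variable {Z β : Type*} {𝒱 : ℕ → Set (Set Z)} {col : ℕ → Z → β} {base : Set Z → Z} {Λ : ℕ}
  {B B' : Set Z}

theorem length_roomDiary (k : ℕ) :
    (roomDiary 𝒱 col base Λ B k).length = (roomList 𝒱 B k).length := by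
  rw [roomDiary, length_diary, length_batches]

theorem exists_roomDiary_append {k k' : ℕ} {S : List (ℕ × Set Z)} (h : S <:+ roomList 𝒱 B k)
    (h' : S <:+ roomList 𝒱 B' k') : ∃ p p' t, roomDiary 𝒱 col base Λ B k = p ++ t ∧
      roomDiary 𝒱 col base Λ B' k' = p' ++ t ∧
      p.length + S.length = (roomList 𝒱 B k).length ∧
      p'.length + S.length = (roomList 𝒱 B' k').length := by
  have key : ∀ {B : Set Z} {k : ℕ}, S <:+ roomList 𝒱 B k →
      ∃ p, roomDiary 𝒱 col base Λ B k = p ++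
        diary Λ (batches Prod.fst (fun U l => (col l (base U.2), ruler l)) S) ∧
        p.length + S.length = (roomList 𝒱 B k).length := by
    rintro B k ⟨P, hP⟩
    refine ⟨(roomDiary 𝒱 col base Λ B k).take P.length, ?_, ?_⟩
    · conv_lhs => rw [← List.take_append_drop P.length (roomDiary 𝒱 col base Λ B k)]
      congr 1
      rw [roomDiary, drop_diary, drop_batches, ← hP, List.drop_left]
    · rw [List.length_take, length_roomDiary, ← hP, List.length_append]
      omega
  obtain ⟨p, hp, hpl⟩ := key h
  obtain ⟨p', hp', hpl'⟩ := key h'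
  exact ⟨p, p', _, hp, hp', hpl, hpl'⟩

/-- This is the source of the lower bound. If the diaries agreed on `(cnt + 1) / 2` letters beyond
`S`, entries of level `N + 3` would agree, for rooms around `z` and `z'` of at least that level.
Base points of equal color at distance at most `(D + 4) σ` are within `2 σ`, so `z` and `z'` would
be within `6 σ`, for `σ` of level `N + 3`. The other half of the rooms is what the distance in the
tree counts. -/
theorem IsLaminar.not_roomDiary_suffix [MetricSpace Z] {s : ℝ} {σ : ℕ → ℝ}
    (h : IsLaminar 𝒱 s σ) (hσ : Antitone σ) (hbase : ∀ V : Set Z, V.Nonempty → base V ∈ V)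
    {D : ℝ} (hcol : ∀ l x y, col l x = col l y → dist x y ≤ (D + 4) * σ l → dist x y ≤ 2 * σ l)
    {z z' : Z} (hz : z ∈ B) (hz' : z' ∈ B') {k k' N cnt : ℕ} (hNk' : N ≤ k') (hk : k' ≤ k)
    (hclose : dist z z' ≤ D * σ (N + 3)) (hfar : N = k' ∨ 6 * σ (N + 3) < dist z z')
    {S : List (ℕ × Set Z)} (hS : S <:+ roomList 𝒱 B N) (hS' : S <:+ roomList 𝒱 B' N)
    (hSl : (roomList 𝒱 B N).length ≤ S.length + 2)
    (hSl' : (roomList 𝒱 B' N).length ≤ S.length + 2)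
    (hcnt : S.length + cnt ≤ (roomList 𝒱 B k).length) (hcnt5 : 5 ≤ cnt)
    (hbudget : 6 * (k - N) ≤ Λ * ((cnt + 1) / 2 - 3)) (hΛ : 0 < Λ) (hK : Λ * 3 ≤ 5 * (k - N)) :
    ¬ (roomDiary 𝒱 col base Λ B k).drop
        ((roomDiary 𝒱 col base Λ B k).length - (S.length + (cnt + 1) / 2)) <:+
      roomDiary 𝒱 col base Λ B' k' := by
  intro hsuf
  set q := S.length + (cnt + 1) / 2 with hq
  have hqR : q ≤ (roomList 𝒱 B k).length := by omega
  have hqR' : q ≤ (roomList 𝒱 B' k').length := by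
    have := hsuf.length_le
    rw [List.length_drop, length_roomDiary, length_roomDiary] at this
    omega
  set m := (roomList 𝒱 B k).length - q with hm
  set m' := (roomList 𝒱 B' k').length - q with hm'
  have hlR : ((roomList 𝒱 B k).drop m).length = q := by rw [List.length_drop]; omega
  have hlR' : ((roomList 𝒱 B' k').drop m').length = q := by rw [List.length_drop]; omega
  have hsuffix : ∀ {B : Set Z} {k : ℕ}, N ≤ k → S <:+ roomList 𝒱 B N →
      q ≤ (roomList 𝒱 B k).length →
      S <:+ (roomList 𝒱 B k).drop ((roomList 𝒱 B k).length - q) := by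
    intro B k hk hS hqB
    refine List.suffix_of_suffix_length_le (hS.trans (roomList_suffix hk)) (List.drop_suffix _ _) ?_
    rw [List.length_drop]
    omega
  obtain ⟨P, hP⟩ := hsuffix (hNk'.trans hk) hS hqR
  obtain ⟨P', hP'⟩ := hsuffix hNk' hS' hqR'
  have hword : diary Λ (batches Prod.fst (fun U l => (col l (base U.2), ruler l))
      ((roomList 𝒱 B k).drop m)) = diary Λ (batches Prod.fst
        (fun U l => (col l (base U.2), ruler l)) ((roomList 𝒱 B' k').drop m')) := by
    rw [← drop_batches, ← drop_batches, ← drop_diary, ← drop_diary]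
    have h1 : (roomDiary 𝒱 col base Λ B k).drop m <:+ (roomDiary 𝒱 col base Λ B' k').drop m' := by
      rw [length_roomDiary] at hsuf
      refine List.suffix_of_suffix_length_le hsuf (List.drop_suffix _ _) ?_
      rw [List.length_drop, List.length_drop, length_roomDiary, length_roomDiary]
      omega
    refine h1.eq_of_length ?_
    rw [List.length_drop, List.length_drop, length_roomDiary, length_roomDiary]
    omega
  obtain ⟨U, hU, U', hU', hlU, hlU', heq⟩ := exists_entry_eq_of_diary_eq
    (lv := Prod.fst) (f := fun U l => col l (base U.2)) (C₀ := 3) (N := N) (K := k - N)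
    ((levelSorted_roomList k).drop m) ((levelSorted_roomList k').drop m') hP.symm hP'.symm
    (hlR.trans hlR'.symm)
    (fun n hn => by
      rw [List.drop_drop] at hn ⊢
      exact lt_topLevel_drop_roomList (by omega))
    (fun n hn => by
      rw [List.drop_drop] at hn ⊢
      exact lt_topLevel_drop_roomList (by omega))
    ((topLevel_drop_roomList_le k m).trans (by omega))
    ((topLevel_drop_roomList_le k' m').trans (by omega))
    hword (by omega)
    (by
      rw [hlR]
      refine hbudget.trans (Nat.mul_le_mul_left _ ?_)
      omega)
    hΛ hK (l := N + 3) (by omega) le_rfl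
  obtain ⟨-, -, hUV, hBU⟩ := mem_roomList (List.mem_of_mem_drop hU)
  obtain ⟨-, hUk', hUV', hBU'⟩ := mem_roomList (List.mem_of_mem_drop hU')
  have h1 := h.diam_le _ _ hUV z (hBU hz) _ (hbase U.2 ⟨z, hBU hz⟩)
  have h2 := h.diam_le _ _ hUV' z' (hBU' hz') _ (hbase U'.2 ⟨z', hBU' hz'⟩)
  have h3 := hσ hlU
  have h4 := hσ hlU'
  rcases hfar with rfl | hfar
  -- Here the second list has no room of level `N + 3` at all.
  · omega
  · have h5 := dist_triangle4 (base U.2) z z' (base U'.2)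
    rw [dist_comm (base U.2) z] at h5
    have h6 := hcol (N + 3) _ _ heq (by linarith)
    have h7 := dist_triangle4 z (base U.2) (base U'.2) z'
    rw [dist_comm (base U'.2) z'] at h7
    linarith

end RoomDiary

/-- The hyperbolic cone over a bounded doubling space `Z` of capacity dimension at most `n`, with
the points `(z, k)`, embeds into the product of `n + 1` binary trees: the distance of `(z, k)` and
`(z', k')` is `k + k' - 2 N` up to constants, where `N` is the level on which they separate. -/
theorem exists_cone_embedding {Z : Type*} [MetricSpace Z] (hdoub : IsDoublingSpace Z) {n : ℕ}
    (hcap : CapacityDimProperty Z n) {Δ : ℝ} (hΔ : ∀ x y : Z, dist x y ≤ Δ) :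
    ∃ (r κ A C : ℝ) (F : Z → ℕ → Fin (n + 1) → BinaryMetricTree), 0 < r ∧ r < 1 ∧ 0 < κ ∧ 0 < A ∧
      0 ≤ C ∧ ∀ (z z' : Z) (k k' N : ℕ), N ≤ k → N ≤ k' → (N = 0 ∨ dist z z' < κ * r ^ N) →
        (N = k ∨ N = k' ∨ κ * r ^ (N + 1) ≤ dist z z') →
        A * (k + k' - 2 * N) - C ≤ dist (F z k) (F z' k') ∧
          dist (F z k) (F z' k') ≤ C * (k + k' - 2 * N) + C := by
  classical
  obtain ⟨s, κ, hs0, hs4, hκ, 𝒱, hlam, hdeep⟩ := hcap.exists_laminar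
  rcases isEmpty_or_nonempty Z with hZ | hZ
  · exact ⟨1 / 2, 1, 1, 1, fun z => isEmptyElim z, by norm_num, by norm_num, one_pos, one_pos,
      zero_le_one, fun z => isEmptyElim z⟩
  set r : ℝ := s / 4 with hr
  have hr0 : 0 < r := by positivity
  have hr1 : r < 1 := by rw [hr]; linarith
  set σ : ℕ → ℝ := fun i => κ * r ^ i with hσdef
  have hσ0 : ∀ i, 0 < σ i := fun i => by positivity
  have hσ : Antitone σ := fun i j hij =>
    mul_le_mul_of_nonneg_left (pow_le_pow_of_le_one hr0.le hr1.le hij) hκ.le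
  have hsσ : ∀ i, 0 < s * σ i := fun i => mul_pos hs0 (hσ0 i)
  have hanti : ∀ i j, i ≤ j → s * σ j ≤ s * σ i := fun i j hij =>
    mul_le_mul_of_nonneg_left (hσ hij) hs0.le
  have hΔ0 : 0 ≤ Δ := by
    obtain ⟨x⟩ := hZ
    simpa using hΔ x x
  -- With this choice `D * σ (N + 3) = (s + Δ / κ) * σ N`, which bounds the distance both if it is
  -- less than `s * σ N` and, by the diameter, if `N = 0`.
  set D : ℝ := (s + Δ / κ) / r ^ 3 with hD
  obtain ⟨Q, hQ⟩ := hdoub.exists_local_coloring (D + 4)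
  choose col hcol using fun l => hQ (σ l) (hσ0 l)
  set base : Set Z → Z := fun V => Classical.epsilon fun x => x ∈ V with hbase
  have hbaseV : ∀ V : Set Z, V.Nonempty → base V ∈ V := fun V hV => Classical.epsilon_spec hV
  -- Since `k - N ≤ cnt * (n + 1)`, half of the `cnt` rooms can carry `12 * (k - N)` entries. The
  -- loss of three rooms costs `3 * Λ ≤ k - N`, and `6 * (k - N)` are needed.
  set Λ : ℕ := 24 * (n + 1) with hΛ
  have hfin : Finite {l : List ((Fin (Q + 1) × Bool) × Bool) // l.length ≤ Λ} :=
    (List.finite_length_le _ Λ).to_subtype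
  obtain ⟨g, b, hb, hgu, hgl⟩ := exists_tree_coding
    {l : List ((Fin (Q + 1) × Bool) × Bool) // l.length ≤ Λ}
  set w : Fin (n + 1) → Z → ℕ → _ := fun c z k =>
    roomDiary (𝒱 c) col base Λ (Metric.ball z (s * σ k)) k with hw
  -- the lower bound, where the first point is the deeper one
  have lower : ∀ (z z' : Z) (k k' N : ℕ), N ≤ k' → k' ≤ k → (N = 0 ∨ dist z z' < s * σ N) →
      (N = k' ∨ s * σ (N + 1) ≤ dist z z') →
      ∃ c, ((k : ℝ) - N) / (2 * (n + 1)) - (3 * Λ + 1) ≤ dist (g (w c z k)) (g (w c z' k')) := by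
    intro z z' k k' N hN hk hclose hfar
    -- For small `k - N` the additive constant makes the bound trivial.
    by_cases hK : k - N < 3 * Λ
    · refine ⟨0, le_trans ?_ dist_nonneg⟩
      have h1 : (k : ℝ) - N ≤ 3 * Λ := by
        have : (k : ℝ) ≤ N + 3 * Λ := by exact_mod_cast (by omega : k ≤ N + 3 * Λ)
        linarith
      have h2 : ((k : ℝ) - N) / (2 * (n + 1)) ≤ (k : ℝ) - N := by
        refine div_le_self ?_ ?_
        · have : (N : ℝ) ≤ k := by exact_mod_cast hN.trans hk
          linarith
        · have : (0 : ℝ) ≤ n := by positivity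
          linarith
      linarith
    push Not at hK
    have hsum := le_sum_length_roomList (𝒱 := 𝒱) (B := Metric.ball z (s * σ k)) (hN.trans hk)
      (fun j h1 h2 => by
        obtain ⟨c, V, hV, hsub⟩ := hdeep j h1 z
        exact ⟨c, V, hV, (Metric.ball_subset_ball (hanti _ _ h2)).trans hsub⟩)
    -- Pigeonhole: some color has at least the average number of rooms on the levels between `N` and
    -- `k`.
    obtain ⟨c, -, hc⟩ := Finset.exists_le_of_sum_le (s := Finset.univ)
      (f := fun _ : Fin (n + 1) => ((k - N : ℕ) : ℚ) / (n + 1))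
      (g := fun c => (((roomList (𝒱 c) (Metric.ball z (s * σ k)) k).length -
        (roomList (𝒱 c) (Metric.ball z (s * σ k)) N).length : ℕ) : ℚ)) Finset.univ_nonempty (by
        rw [Finset.sum_const, Finset.card_univ, Fintype.card_fin, nsmul_eq_mul, Nat.cast_add,
          Nat.cast_one, mul_div_cancel₀ _ (by positivity)]
        exact_mod_cast hsum)
    set cnt := (roomList (𝒱 c) (Metric.ball z (s * σ k)) k).length -
        (roomList (𝒱 c) (Metric.ball z (s * σ k)) N).length with hcnt
    rw [div_le_iff₀ (by positivity)] at hc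
    have hc' : k - N ≤ cnt * (n + 1) := by exact_mod_cast hc
    obtain ⟨S, hS, hS', hSl, hSl'⟩ := (hlam c).exists_common_suffix hsσ hanti (hN.trans hk) hN hclose
    have hlen := (roomList_suffix (𝒱 := 𝒱 c) (B := Metric.ball z (s * σ k)) (hN.trans hk)).length_le
    have hSle := hS.length_le
    have hcnt72 : 72 ≤ cnt := by
      have : 72 * (n + 1) ≤ cnt * (n + 1) := by omega
      exact Nat.le_of_mul_le_mul_right this (by omega)
    have hpow : σ (N + 3) = r ^ 3 * σ N := by simp only [hσdef]; ring
    have hpow' : σ (N + 3) = r ^ 2 * σ (N + 1) := by simp only [hσdef]; ring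
    have hnot := (hlam c).not_roomDiary_suffix (col := col) (Λ := Λ) (cnt := cnt) hσ hbaseV hcol
      (Metric.mem_ball_self (hsσ k)) (Metric.mem_ball_self (hsσ k')) hN hk
      (by
        rw [hpow, hD, div_mul_eq_mul_div, mul_left_comm, mul_div_cancel_left₀ _ (by positivity)]
        rcases hclose with rfl | hclose
        · have h1 : σ 0 = κ := by simp [hσdef]
          have h2 := hΔ z z'
          rw [h1, add_mul, div_mul_cancel₀ _ hκ.ne']
          have := mul_pos hs0 hκ
          linarith
        · have : 0 ≤ Δ / κ * σ N := mul_nonneg (by positivity) (hσ0 N).le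
          rw [add_mul]
          linarith)
      -- As `r = s / 4`, one has `6 * r ^ 2 < s` but not `6 * r < s`; this is why colors are
      -- compared on level `N + 3`.
      (hfar.imp_right fun hfar => by
        refine lt_of_lt_of_le ?_ hfar
        rw [hpow', ← mul_assoc]
        refine mul_lt_mul_of_pos_right ?_ (hσ0 _)
        rw [hr]
        nlinarith)
      hS hS' hSl hSl' (by omega) (by omega)
      (by
        have h1 : 12 * (cnt * (n + 1)) ≤ Λ * ((cnt + 1) / 2) := by
          rw [hΛ]
          calc 12 * (cnt * (n + 1)) = 12 * (n + 1) * cnt := by ring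
            _ ≤ 12 * (n + 1) * (2 * ((cnt + 1) / 2)) := Nat.mul_le_mul_left _ (by omega)
            _ = 24 * (n + 1) * ((cnt + 1) / 2) := by ring
        rw [Nat.mul_sub Λ]
        omega)
      (by omega) (by omega)
    refine ⟨c, ?_⟩
    have hd := hgl _ _ _ (by rw [length_roomDiary]; omega) hnot
    refine le_trans ?_ hd
    rw [length_roomDiary]
    have h1 : cnt ≤ 2 * ((roomList (𝒱 c) (Metric.ball z (s * σ k)) k).length -
        (S.length + (cnt + 1) / 2)) + 1 := by omega
    have h2 : (cnt : ℝ) ≤ 2 * ((roomList (𝒱 c) (Metric.ball z (s * σ k)) k).length -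
        (S.length + (cnt + 1) / 2) : ℕ) + 1 := by exact_mod_cast h1
    have h3 : ((k : ℝ) - N) / (2 * (n + 1)) ≤ cnt / 2 := by
      rw [div_le_div_iff₀ (by positivity) (by norm_num)]
      have : ((k - N : ℕ) : ℝ) ≤ cnt * (n + 1) := by exact_mod_cast hc'
      rw [Nat.cast_sub (hN.trans hk)] at this
      nlinarith
    have h4 : (0 : ℝ) ≤ Λ := by positivity
    linarith
  refine ⟨r, s * κ, 1 / (4 * (n + 1)), 3 * Λ + 1 + 4 * b, fun z k c => g (w c z k), hr0, hr1,
    mul_pos hs0 hκ, by positivity, by positivity, ?_⟩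
  intro z z' k k' N hNk hNk' hclose hfar
  have hsσ' : ∀ i, s * κ * r ^ i = s * σ i := fun i => mul_assoc _ _ _
  rw [hsσ'] at hclose hfar
  have hNk₁ : (N : ℝ) ≤ k := by exact_mod_cast hNk
  have hNk₂ : (N : ℝ) ≤ k' := by exact_mod_cast hNk'
  constructor
  · have hdiv : ∀ x y : ℝ, y ≤ 2 * x →
        1 / (4 * ((n : ℝ) + 1)) * y ≤ x / (2 * (n + 1)) := by
      intro x y hxy
      rw [one_div_mul_eq_div, div_le_div_iff₀ (by positivity) (by positivity)]
      have : (0 : ℝ) < n + 1 := by positivity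
      nlinarith
    rcases le_total k' k with hk | hk
    · have hk₁ : (k' : ℝ) ≤ k := by exact_mod_cast hk
      obtain ⟨c, hc⟩ := lower z z' k k' N hNk' hk hclose (by
        rcases hfar with h | h | h
        · exact Or.inl (by omega)
        · exact Or.inl h
        · exact Or.inr h)
      refine le_trans ?_ (hc.trans
        (dist_le_pi_dist (fun c => g (w c z k)) (fun c => g (w c z' k')) c))
      have := hdiv (k - N) (k + k' - 2 * N) (by linarith)
      linarith
    · have hk₁ : (k : ℝ) ≤ k' := by exact_mod_cast hk
      obtain ⟨c, hc⟩ := lower z' z k' k N hNk hk (by rwa [dist_comm]) (by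
        rw [dist_comm]
        rcases hfar with h | h | h
        · exact Or.inl h
        · exact Or.inl (by omega)
        · exact Or.inr h)
      rw [dist_comm] at hc
      refine le_trans ?_ (hc.trans
        (dist_le_pi_dist (fun c => g (w c z k)) (fun c => g (w c z' k')) c))
      have := hdiv (k' - N) (k + k' - 2 * N) (by linarith)
      linarith
  · have h4 : (0 : ℝ) ≤ Λ := by positivity
    refine (dist_pi_le_iff ?_).2 fun c => ?_
    · have : 0 ≤ (3 * (Λ : ℝ) + 1 + 4 * b) * (k + k' - 2 * N) :=
        mul_nonneg (by linarith) (by linarith)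
      linarith
    · obtain ⟨S, hS, hS', hSl, hSl'⟩ := (hlam c).exists_common_suffix hsσ hanti hNk hNk' hclose
      obtain ⟨p, p', t, hp, hp', hpl, hpl'⟩ := exists_roomDiary_append (col := col) (base := base)
        (Λ := Λ) (hS.trans (roomList_suffix hNk)) (hS'.trans (roomList_suffix hNk'))
      have h1 := hgu p p' t
      rw [← hp, ← hp'] at h1
      refine h1.trans ?_
      have h2 := length_roomList_le (𝒱 := 𝒱 c) (B := Metric.ball z (s * σ k)) hNk
      have h3 := length_roomList_le (𝒱 := 𝒱 c) (B := Metric.ball z' (s * σ k')) hNk'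
      -- Beyond `S` each list has at most two rooms of level at most `N` and at most one for each
      -- later level.
      have h5 : p.length + p'.length + 2 * N ≤ k + k' + 4 := by omega
      have h6 : (p.length : ℝ) + p'.length ≤ k + k' - 2 * N + 4 := by
        have : (p.length : ℝ) + p'.length + 2 * N ≤ k + k' + 4 := by exact_mod_cast h5
        linarith
      have h7 : b * ((p.length : ℝ) + p'.length) ≤ b * (k + k' - 2 * N + 4) :=
        mul_le_mul_of_nonneg_left h6 hb.le
      have h8 : 0 ≤ (3 * (Λ : ℝ) + 1 + 3 * b) * (k + k' - 2 * N) :=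
        mul_nonneg (by linarith) (by linarith)
      nlinarith

/-! ### Gromov products with boundary points -/

section Boundary

variable {X : Type*} [MetricSpace X]

theorem gromovProd_comm (o x y : X) : gromovProd o x y = gromovProd o y x := by
  simp only [gromovProd, dist_comm x y]
  ring

theorem gromovProd_nonneg (o x y : X) : 0 ≤ gromovProd o x y := by
  have := dist_triangle_left x y o
  rw [gromovProd]
  linarith

theorem gromovProd_le_left (o x y : X) : gromovProd o x y ≤ dist o x := by
  have := dist_triangle o x y
  rw [gromovProd]
  linarith

theorem gromovProd_le_right (o x y : X) : gromovProd o x y ≤ dist o y := by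
  rw [gromovProd_comm]
  exact gromovProd_le_left o y x

variable [GromovHyperbolic X]

theorem GromovBoundary.exists_mem (ξ : GromovBoundary X) : ∃ x, ξ.Mem x := by
  obtain ⟨x, rfl⟩ := Quotient.exists_rep ξ
  exact ⟨x.1, x.2, rfl⟩

theorem eventually_le_gromovProd_of_le_pointBoundaryProd {o y : X} {ξ : GromovBoundary X} {t : ℝ}
    {D : ℝ} (h : (t : EReal) ≤ pointBoundaryProd o y ξ + (D : EReal)) {x : ℕ → X} (hx : ξ.Mem x) :
    ∀ᶠ i in atTop, t - D - 1 < gromovProd o y (x i) := by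
  have h1 : pointBoundaryProd o y ξ ≤ liminf (fun i => (gromovProd o y (x i) : EReal)) atTop :=
    iInf₂_le x hx
  have h2 : ((t - D : ℝ) : EReal) ≤ pointBoundaryProd o y ξ := by
    rw [EReal.coe_sub]
    exact EReal.sub_le_of_le_add h
  have h3 : ((t - D - 1 : ℝ) : EReal) < ((t - D : ℝ) : EReal) := by
    rw [EReal.coe_lt_coe_iff]
    linarith
  filter_upwards [eventually_lt_of_lt_liminf (h3.trans_le (h2.trans h1))] with i hi
  exact_mod_cast hi

theorem eventually_lt_gromovProd_of_lt_boundaryProd {o : X} {ξ ξ' : GromovBoundary X} {t : ℝ}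
    (h : (t : EReal) < boundaryProd o ξ ξ') {x x' : ℕ → X} (hx : ξ.Mem x) (hx' : ξ'.Mem x') :
    ∀ᶠ i in atTop, t < gromovProd o (x i) (x' i) := by
  have h1 : boundaryProd o ξ ξ' ≤ liminf (fun i => (gromovProd o (x i) (x' i) : EReal)) atTop :=
    (iInf₂_le x hx).trans (iInf₂_le x' hx')
  filter_upwards [eventually_lt_of_lt_liminf (h.trans_le h1)] with i hi
  exact_mod_cast hi

theorem exists_frequently_gromovProd_lt {o : X} {ξ ξ' : GromovBoundary X} {t : ℝ}
    (h : boundaryProd o ξ ξ' < (t : EReal)) :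
    ∃ x x', ξ.Mem x ∧ ξ'.Mem x' ∧ ∃ᶠ i in atTop, gromovProd o (x i) (x' i) < t := by
  simp only [boundaryProd, iInf_lt_iff] at h
  obtain ⟨x, hx, x', hx', h⟩ := h
  refine ⟨x, x', hx, hx', (frequently_lt_of_liminf_lt (by isBoundedDefault) h).mono fun i hi => ?_⟩
  exact_mod_cast hi

theorem boundaryProd_nonneg (o : X) (ξ ξ' : GromovBoundary X) : 0 ≤ boundaryProd o ξ ξ' :=
  le_iInf₂ fun x _ => le_iInf₂ fun x' _ => le_liminf_of_le (by isBoundedDefault)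
    (Eventually.of_forall fun i => by exact_mod_cast gromovProd_nonneg o (x i) (x' i))

/-- The points `y` lie on rays from `o` to the boundary points `ξ y`, up to a constant `E`. -/
def IsShadow (o : X) (E : ℝ) (ξ : X → GromovBoundary X) : Prop :=
  ∀ (y : X) (x : ℕ → X), (ξ y).Mem x → ∀ᶠ i in atTop, dist o y - E ≤ gromovProd o y (x i)

/-- The base point of visuality need not be that of the visual metric. The change costs `dist o o'`
in the Gromov product and again in the distance; the `1` pays for passing from a liminf to its
terms. -/
theorem IsVisualSpace.exists_isShadow (h : IsVisualSpace X) (o : X) :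
    ∃ (E : ℝ) (ξ : X → GromovBoundary X), 0 ≤ E ∧ IsShadow o E ξ := by
  obtain ⟨o', D, hD, h⟩ := h
  choose ξ hξ using h
  refine ⟨D + 1 + 2 * dist o o', ξ, by positivity, fun y x hx => ?_⟩
  filter_upwards [eventually_le_gromovProd_of_le_pointBoundaryProd (hξ y) hx] with i hi
  have h1 := gromovProd_base o' o y (x i)
  have h2 := dist_triangle o o' y
  rw [dist_comm o' o] at h1
  linarith

variable {o : X} {E δ : ℝ} {ξ : X → GromovBoundary X}

/-- Hyperbolicity is applied along `x`, `u i`, `v i`, `y`, where `u` and `v` represent the two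
boundary points. -/
theorem IsShadow.le_gromovProd (h : IsShadow o E ξ) (hE : 0 ≤ E) (hδ0 : 0 ≤ δ)
    (hδ : ∀ o x y z : X, min (gromovProd o x y) (gromovProd o y z) - δ ≤ gromovProd o x z)
    {x y : X} {t : ℝ} (ht : (t : EReal) < boundaryProd o (ξ x) (ξ y)) (hx : t ≤ dist o x)
    (hy : t ≤ dist o y) : t - E - 2 * δ ≤ gromovProd o x y := by
  obtain ⟨u, hu⟩ := (ξ x).exists_mem
  obtain ⟨v, hv⟩ := (ξ y).exists_mem
  obtain ⟨i, ⟨h1, h2⟩, h3⟩ := ((h x u hu).and (h y v hv)).and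
    (eventually_lt_gromovProd_of_lt_boundaryProd ht hu hv) |>.exists
  have h4 := hδ o x (u i) (v i)
  have h5 := hδ o x (v i) y
  rw [gromovProd_comm o (v i) y] at h5
  have h6 : t - E ≤ min (gromovProd o x (u i)) (gromovProd o (u i) (v i)) :=
    le_min (by linarith) (by linarith)
  have h7 : t - E - δ ≤ min (gromovProd o x (v i)) (gromovProd o y (v i)) :=
    le_min (by linarith) (by linarith)
  linarith

/-- Hyperbolicity is now applied along `u i`, `x`, `y`, `v i`. A small liminf gives small products
only for infinitely many `i`, which is enough because the shadow bounds hold eventually. -/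
theorem IsShadow.gromovProd_le (h : IsShadow o E ξ) (hE : 0 ≤ E) (hδ0 : 0 ≤ δ)
    (hδ : ∀ o x y z : X, min (gromovProd o x y) (gromovProd o y z) - δ ≤ gromovProd o x z)
    {x y : X} {t : ℝ} (ht : boundaryProd o (ξ x) (ξ y) < (t : EReal)) :
    gromovProd o x y ≤ t + E + 2 * δ := by
  obtain ⟨u, v, hu, hv, hf⟩ := exists_frequently_gromovProd_lt ht
  obtain ⟨i, h3, h1, h2⟩ := (hf.and_eventually ((h x u hu).and (h y v hv))).exists
  have h4 := hδ o x y (v i)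
  have h5 := hδ o (u i) x (v i)
  rw [gromovProd_comm o (u i) x] at h5
  have hx := gromovProd_le_left o x y
  have hy := gromovProd_le_right o x y
  have h6 : gromovProd o x y - E ≤ min (gromovProd o x y) (gromovProd o y (v i)) :=
    le_min (by linarith) (by linarith)
  have h7 : gromovProd o x y - E - δ ≤ min (gromovProd o x (u i)) (gromovProd o x (v i)) :=
    le_min (by linarith) (by linarith)
  linarith

end Boundary

/-! ### Comparison of boundary products with geometric scales. -/

section Scales

theorem powNeg_coe (a b : ℝ) : powNeg a (b : EReal) = a ^ (-b) := by
  rw [powNeg, if_neg (EReal.coe_ne_top b), EReal.toReal_coe]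

theorem powNeg_top (a : ℝ) : powNeg a ⊤ = 0 := if_pos rfl

theorem powNeg_le_one {a : ℝ} (ha : 1 < a) {t : EReal} (ht : 0 ≤ t) : powNeg a t ≤ 1 := by
  induction t with
  | bot => simp at ht
  | top => rw [powNeg_top]; exact zero_le_one
  | coe b =>
    rw [powNeg_coe]
    exact Real.rpow_le_one_of_one_le_of_nonpos ha.le (by simpa using ht)

theorem pow_eq_rpow_logb {a r : ℝ} (ha : 1 < a) (hr : 0 < r) (N : ℕ) :
    r ^ N = a ^ (N * Real.logb a r) := by
  rw [mul_comm, Real.rpow_mul (by linarith), Real.rpow_logb (by linarith) ha.ne' hr,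
    Real.rpow_natCast]

/-- Taking logarithms to base `a` turns one level into a step of length `-Real.logb a r` in the
boundary product. -/
theorem lt_of_powNeg_lt {a c κ r : ℝ} (ha : 1 < a) (hc : 0 < c) (hκ : 0 < κ) (hr : 0 < r) {N : ℕ}
    {t : EReal} (ht : 0 ≤ t) (h : c * powNeg a t < κ * r ^ N) :
    ((-Real.logb a r * N - |Real.logb a (κ / c)| - 1 : ℝ) : EReal) < t := by
  induction t with
  | bot => simp at ht
  | top => exact EReal.coe_lt_top _
  | coe b =>
    rw [powNeg_coe, pow_eq_rpow_logb ha hr] at h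
    rw [EReal.coe_lt_coe_iff]
    have h1 : a ^ (-b) < a ^ (Real.logb a (κ / c) + N * Real.logb a r) := by
      rw [Real.rpow_add (by linarith), Real.rpow_logb (by linarith) ha.ne' (by positivity),
        div_mul_eq_mul_div, lt_div_iff₀ hc, mul_comm]
      exact h
    rw [Real.rpow_lt_rpow_left_iff ha] at h1
    have := le_abs_self (Real.logb a (κ / c))
    linarith

theorem lt_of_le_powNeg {a c κ r : ℝ} (ha : 1 < a) (hc : 0 < c) (hκ : 0 < κ) (hr : 0 < r) {N : ℕ}
    {t : EReal} (ht : 0 ≤ t) (h : κ * r ^ N ≤ c * powNeg a t) :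
    t < ((-Real.logb a r * N + |Real.logb a (κ / c)| + 1 : ℝ) : EReal) := by
  induction t with
  | bot => simp at ht
  | top =>
    rw [powNeg_top, mul_zero] at h
    have : 0 < κ * r ^ N := by positivity
    linarith
  | coe b =>
    rw [powNeg_coe, pow_eq_rpow_logb ha hr] at h
    rw [EReal.coe_lt_coe_iff]
    have h1 : a ^ (Real.logb a (κ / c) + N * Real.logb a r) ≤ a ^ (-b) := by
      rw [Real.rpow_add (by linarith), Real.rpow_logb (by linarith) ha.ne' (by positivity),
        div_mul_eq_mul_div, div_le_iff₀ hc, mul_comm (a ^ (-b))]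
      exact h
    rw [Real.rpow_le_rpow_left_iff ha] at h1
    have := neg_abs_le (Real.logb a (κ / c))
    linarith

end Scales

/-! ### The quasi-isometric embedding of the space. -/

theorem theorem1p2 {X : Type*} [MetricSpace X] [GromovHyperbolic X]
    (hX : IsVisualSpace X)
    [MetricSpace (GromovBoundary X)] (hvis : IsVisualMetric X)
    (hdoub : IsDoublingSpace (GromovBoundary X)) :
    ∃ n : ℕ, capacityDim (GromovBoundary X) = (n : ℕ∞) ∧
      ∃ f : X → (Fin (n + 1) → BinaryMetricTree), IsQuasiIsometricEmbedding f := by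
  obtain ⟨n, hn, hcap⟩ := exists_capacityDim_eq hdoub.exists_capacityDimProperty
  refine ⟨n, hn, ?_⟩
  obtain ⟨o, a, c₁, c₂, ha, hc₁, hc₂, hd⟩ := hvis
  obtain ⟨r, κ, A, C, F, hr0, hr1, hκ, hA, hC, hF⟩ := exists_cone_embedding hdoub hcap (Δ := c₂)
    (fun ξ ξ' => (hd ξ ξ').2.trans
      (mul_le_of_le_one_right hc₂.le (powNeg_le_one ha (boundaryProd_nonneg o ξ ξ'))))
  obtain ⟨E, ξ, hE, hξ⟩ := hX.exists_isShadow o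
  obtain ⟨δ, hδ0, hδ'⟩ := GromovHyperbolic.exists_delta (X := X)
  have hδ : ∀ o x y z : X, min (gromovProd o x y) (gromovProd o y z) - δ ≤ gromovProd o x z :=
    fun o x y z => (hδ' o x y z).2.2
  set h : ℝ := -Real.logb a r with hh
  have hh0 : 0 < h := neg_pos.2 (Real.logb_neg ha hr0 hr1)
  set L : ℝ := h + |Real.logb a (κ / c₁)| + |Real.logb a (κ / c₂)| + 1 + E + 2 * δ with hL
  have hL1 := abs_nonneg (Real.logb a (κ / c₁))
  have hL2 := abs_nonneg (Real.logb a (κ / c₂))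
  -- The unit `h` is the change of the boundary product from one level to the next, so `x` is placed
  -- in the cone at level `|ox| / h`, rounded down.
  set m : X → ℕ := fun x => ⌊dist o x / h⌋₊ with hm
  have hm1 : ∀ x, h * m x ≤ dist o x := fun x => by
    have := Nat.floor_le (div_nonneg (dist_nonneg (x := o) (y := x)) hh0.le)
    rw [le_div_iff₀ hh0] at this
    rwa [mul_comm]
  have hm2 : ∀ x, dist o x ≤ h * m x + h := fun x => by
    have := (Nat.lt_floor_add_one (dist o x / h)).le
    rw [div_le_iff₀ hh0] at this
    linarith
  -- distances in `X` are distances in the cone up to constants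
  have key : ∀ x y, ∃ T : ℝ, h * T - (2 * h + 2 * L) ≤ dist x y ∧
      dist x y ≤ h * T + (2 * h + 2 * L) ∧
      A * T - C ≤ dist (F (ξ x) (m x)) (F (ξ y) (m y)) ∧
      dist (F (ξ x) (m x)) (F (ξ y) (m y)) ≤ C * T + C := by
    intro x y
    classical
    -- The level of separation, for which `(x|y)_o` is `h * N` up to `L`. If `N` is stopped by `m x`
    -- or `m y`, the upper bound comes from `(x|y)_o ≤ |ox|` or `(x|y)_o ≤ |oy|`.
    set N := Nat.findGreatest (fun N => N = 0 ∨ dist (ξ x) (ξ y) < κ * r ^ N)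
      (min (m x) (m y)) with hN
    have hNle : N ≤ min (m x) (m y) := Nat.findGreatest_le _
    have hNx : N ≤ m x := hNle.trans (min_le_left _ _)
    have hNy : N ≤ m y := hNle.trans (min_le_right _ _)
    have hNP : N = 0 ∨ dist (ξ x) (ξ y) < κ * r ^ N :=
      Nat.findGreatest_spec (P := fun N => N = 0 ∨ dist (ξ x) (ξ y) < κ * r ^ N)
        (Nat.zero_le _) (Or.inl rfl)
    have hNmax : N = m x ∨ N = m y ∨ κ * r ^ (N + 1) ≤ dist (ξ x) (ξ y) := by
      by_contra! hcon
      have hlt : N + 1 ≤ min (m x) (m y) := le_min (by omega) (by omega)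
      have := Nat.le_findGreatest (P := fun N => N = 0 ∨ dist (ξ x) (ξ y) < κ * r ^ N) hlt
        (Or.inr hcon.2.2)
      omega
    have hNx' : h * N ≤ h * m x := mul_le_mul_of_nonneg_left (by exact_mod_cast hNx) hh0.le
    have hNy' : h * N ≤ h * m y := mul_le_mul_of_nonneg_left (by exact_mod_cast hNy) hh0.le
    have hlow : h * N - L ≤ gromovProd o x y := by
      rcases hNP with h0 | hlt
      · rw [h0]
        have := gromovProd_nonneg o x y
        simp only [Nat.cast_zero, mul_zero]
        linarith
      · have h1 := lt_of_powNeg_lt ha hc₁ hκ hr0 (boundaryProd_nonneg o (ξ x) (ξ y))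
          ((hd (ξ x) (ξ y)).1.trans_lt hlt)
        rw [← hh] at h1
        have h2 := hξ.le_gromovProd hE hδ0 hδ h1 (by linarith [hm1 x]) (by linarith [hm1 y])
        linarith
    have hup : gromovProd o x y ≤ h * N + L := by
      rcases hNmax with h0 | h0 | hge
      · have := gromovProd_le_left o x y
        have := hm2 x
        rw [← h0] at this
        linarith
      · have := gromovProd_le_right o x y
        have := hm2 y
        rw [← h0] at this
        linarith
      · have h1 := lt_of_le_powNeg ha hc₂ hκ hr0 (boundaryProd_nonneg o (ξ x) (ξ y))
          (hge.trans (hd (ξ x) (ξ y)).2)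
        rw [← hh] at h1
        have h2 := hξ.gromovProd_le hE hδ0 hδ h1
        push_cast at h2
        linarith
    have hdist : dist x y = dist o x + dist o y - 2 * gromovProd o x y := by
      rw [gromovProd]; ring
    obtain ⟨h1, h2⟩ := hF (ξ x) (ξ y) (m x) (m y) N hNx hNy hNP hNmax
    refine ⟨m x + m y - 2 * N, ?_, ?_, h1, h2⟩
    · linarith [hm1 x, hm1 y]
    · linarith [hm2 x, hm2 y]
  have hL0 : 0 ≤ 2 * h + 2 * L := by linarith
  -- The constant `C` may vanish; `C + 1` makes the upper factor positive.
  refine ⟨fun x => F (ξ x) (m x), A / h, (C + 1) / h,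
    A / h * (2 * h + 2 * L) + (C + 1) / h * (2 * h + 2 * L) + C, by positivity, by positivity,
    by positivity, fun x y => ?_⟩
  obtain ⟨T, h1, h2, h3, h4⟩ := key x y
  have h5 : 0 ≤ A / h * (2 * h + 2 * L) := by positivity
  have h6 : 0 ≤ (C + 1) / h * (2 * h + 2 * L) := by positivity
  constructor
  · have h7 : A / h * dist x y ≤ A / h * (h * T + (2 * h + 2 * L)) :=
      mul_le_mul_of_nonneg_left h2 (by positivity)
    have h8 : A / h * (h * T) = A * T := by field_simp
    rw [mul_add, h8] at h7
    linarith
  · have h7 : (C / h) * (h * T - (2 * h + 2 * L)) ≤ C / h * dist x y :=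
      mul_le_mul_of_nonneg_left h1 (by positivity)
    have h8 : C / h * (h * T) = C * T := by field_simp
    rw [mul_sub, h8] at h7
    have h9 : (C + 1) / h = C / h + 1 / h := add_div _ _ _
    have h10 : 0 ≤ 1 / h * dist x y := by positivity
    have h11 : 0 ≤ 1 / h * (2 * h + 2 * L) := by positivity
    rw [h9]
    linarith
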